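/- Let $\alpha$ be irrational with $0<\alpha<\tfrac12$, with continued fraction expansion $\alpha=[0;a_1,a_2,\dots]$ (so $a_1\ge 2$). On the circle $\mathbb T=[0,1)$ let $R(x)=\{x+\alpha\}$, and fix one of the two conventions $I_0=[0,1-\alpha)$, $I_1=[1-\alpha,1)$ or $I_0=(0,1-\alpha]$, $I_1=(1-\alpha,1]$ (where $1$ is identified with $0$). The Sturmian word $s_{x,\alpha}$ of slope $\alpha$ and intercept $x\in[0,1)$ has $n$-th letter ($n\ge 0$) equal to $0$ if $R^n(x)\in I_0$ and to $1$ otherwise. Let $\mathcal L(\alpha)$ be the set of finite factors of Sturmian words of slope $\alpha$ (under either convention), and for a word $w$ let $[w]$ be the set of all $x\in[0,1)$ such that $s_{x,\alpha}$ begins with $w$. Let $\psi(x)=\tfrac12(x+1-\alpha)$ for $x\in(0,1)$, and $\psi(0)=\tfrac12(1-\alpha)$ under the first convention and $\psi(0)=1-\tfrac{\alpha}{2}$ under the second. A square $w^2\in\mathcal L(\alpha)$ satisfies the *square root condition* if $\psi([w^2])\subseteq[w]$. A word $w$ is *primitive* if $w=z^n$ only for $n=1$. A *minimal square root* of slope $\alpha$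 is a nonempty word $X$ with $X^2\in\mathcal L(\alpha)$ such that no proper prefix of $X^2$ is a nonempty square. A nonempty word $w$ is a *solution in $\mathcal L(\alpha)$* of the word equation $$X_1^2X_2^2\cdots X_n^2=(X_1X_2\cdots X_n)^2\qquad(*)$$ if $w=X_1\cdots X_n$ for some minimal square roots $X_1,\dots,X_n$ of slope $\alpha$ satisfying $(*)$, and $w^2\in\mathcal L(\alpha)$. The *standard words* of slope $\alpha$ are the words $s_k$, $k\ge 0$, where $s_0=0$, $s_1=0^{a_1-1}1$ and $s_k=s_{k-1}^{a_k}s_{k-2}$ for $k\ge 2$; the *semistandard words* are the words $s_{k-1}^{\ell}s_{k-2}$ with $k\ge 2$ and $1\le \ell<a_k$. **Theorem.** Let $w\in\mathcal L(\alpha)$. The following are equivalent. (i) $w$ is primitive and is a solution of $(*)$ in $\mathcal L(\alpha)$. (ii) $w$ is primitive, $w^2\in\mathcal L(\alpha)$, and $w^2$ satisfies the square root condition. (iii) $w$ is the reversal of a standard or semistandard word of slope $\alpha$, or $w$ is obtained from the reversal of a standard word of slope $\alpha$ of length at least $2$ by exchanging its first two letters. -/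

import Mathlib

open Set

namespace SturmianSqrt

/-- Finite binary words. -/
abbrev Word := List (Fin 2)

/-- The power `u ^ n` of a word. -/
def wordPow (u : Word) (n : ℕ) : Word := (List.replicate n u).flatten

/-- The square `u u` of a word. -/
def sq (u : Word) : Word := u ++ u

/-- A word is primitive if it is of the form `z ^ n` only for `n = 1`
(so the empty word is not primitive). -/
def IsPrimitive (w : Word) : Prop := ∀ (z : Word) (n : ℕ), w = wordPow z n → n = 1

/-- A word is a minimal square root if it is nonempty and its square has no (nonempty) square as a
proper prefix. -/
def IsMinimalSquareRoot (u : Word) : Prop :=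
  u ≠ [] ∧ ∀ v : Word, v ≠ [] → sq v <+: sq u → sq v = sq u

/-! ### Sturmian words as codings of rotations

The circle is identified with the interval `[0, 1)`. -/

/-- The two ways to attach the end points `0` and `1 - α` to the intervals of the coding. -/
inductive Convention
  | left
  | right

/-- `I₀` is `[0, 1 - α)` or `(0, 1 - α]`. -/
def I₀ (c : Convention) (α : ℝ) : Set ℝ :=
  match c with
  | .left => Ico 0 (1 - α)
  | .right => Ioc 0 (1 - α)

/-- The rotation `x ↦ {x + α}`. -/
noncomputable def rotation (α x : ℝ) : ℝ := Int.fract (x + α)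

open Classical in
/-- The coding function on `[0, 1)`: it is `0` on `I₀`, and `1` on the complement `I₁`, which is
`[1 - α, 1)` or `(1 - α, 1]` (the point `1` of the circle being the point `0`). -/
noncomputable def coding (c : Convention) (α x : ℝ) : Fin 2 := if x ∈ I₀ c α then 0 else 1

/-- The Sturmian word of slope `α` and intercept `x`. -/
noncomputable def sturmianWord (c : Convention) (α x : ℝ) (n : ℕ) : Fin 2 :=
  coding c α ((rotation α)^[n] x)

/-- The finite word `w` occurs in the infinite word `s` at position `m`. -/
def OccursAt (w : Word) (s : ℕ → Fin 2) (m : ℕ) : Prop :=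
  ∀ (i : ℕ) (h : i < w.length), s (m + i) = w[i]

/-- The language of slope `α`: the factors of the Sturmian words of slope `α`. -/
def language (α : ℝ) : Set Word :=
  {w | ∃ (c : Convention) (x : ℝ), x ∈ Ico (0 : ℝ) 1 ∧ ∃ m, OccursAt w (sturmianWord c α x) m}

/-- The interval `[w]`: the intercepts `x` for which the Sturmian word of slope `α` and intercept `x`
begins with `w`. -/
def interval (c : Convention) (α : ℝ) (w : Word) : Set ℝ :=
  {x | x ∈ Ico (0 : ℝ) 1 ∧ OccursAt w (sturmianWord c α x) 0}

/-- The map `ψ` of the circle, which halves the distance to `1 - α` inside `I₀` and inside `I₁`. -/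
noncomputable def psi (c : Convention) (α x : ℝ) : ℝ :=
  if x = 0 then
    match c with
    | .left => (1 - α) / 2
    | .right => 1 - α / 2
  else (x + 1 - α) / 2

/-- The square `w w` lies in the language of slope `α` and satisfies the square root condition
`ψ([w w]) ⊆ [w]`. -/
def SquareRootCondition (c : Convention) (α : ℝ) (w : Word) : Prop :=
  sq w ∈ language α ∧ psi c α '' interval c α (sq w) ⊆ interval c α w

/-- The nonempty word `w` is a solution, in the language of slope `α`, to the word equation
`X₁² ⋯ Xₙ² = (X₁ ⋯ Xₙ)²`: it is a product `X₁ ⋯ Xₙ` of roots of minimal squares of slope `α`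
that satisfy the equation, and `w w` lies in the language. -/
def IsSolutionIn (α : ℝ) (w : Word) : Prop :=
  w ≠ [] ∧ sq w ∈ language α ∧
    ∃ X : List Word, (∀ x ∈ X, IsMinimalSquareRoot x ∧ sq x ∈ language α) ∧
      w = X.flatten ∧ (X.map sq).flatten = sq X.flatten

/-! ### Standard and semistandard words -/

/-- The partial quotient `a_k` of the continued fraction `α = [a₀; a₁, a₂, …]`, for irrational
`α > 0`. -/
noncomputable def partialQuotient (α : ℝ) (k : ℕ) : ℕ :=
  ((GenContFract.IntFractPair.stream α k).elim 0 (fun p => p.b)).toNat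

/-- The standard words: `s₀ = 0`, `s₁ = 0 ^ (a₁ - 1) 1`, `s_k = s_{k-1} ^ a_k s_{k-2}`. -/
noncomputable def standardWord (α : ℝ) : ℕ → Word
  | 0 => [0]
  | 1 => wordPow [0] (partialQuotient α 1 - 1) ++ [1]
  | k + 2 => wordPow (standardWord α (k + 1)) (partialQuotient α (k + 2)) ++ standardWord α k

/-- The word `s_{k+2,l} = s_{k+1} ^ l s_k`; it is semistandard if `1 ≤ l < a_{k+2}`. -/
noncomputable def semistandardWord (α : ℝ) (k l : ℕ) : Word :=
  wordPow (standardWord α (k + 1)) l ++ standardWord α k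

/-- The set of standard words of slope `α`. -/
def standardWords (α : ℝ) : Set Word := {w | ∃ k, w = standardWord α k}

/-- The set of standard and semistandard words of slope `α`. -/
def semiStandardWords (α : ℝ) : Set Word :=
  standardWords α ∪
    {w | ∃ k l, 1 ≤ l ∧ l < partialQuotient α (k + 2) ∧ w = semistandardWord α k l}

/-- The reversed standard words of slope `α`. -/
def reversedStandardWords (α : ℝ) : Set Word := List.reverse '' standardWords α

/-- The reversed standard and semistandard words of slope `α`. -/
def reversedSemiStandardWords (α : ℝ) : Set Word := List.reverse '' semiStandardWords α

/-- The operation `L`, which exchanges the first two letters of a word of length at least two. -/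
def swapFirstTwo : Word → Word
  | x :: y :: t => y :: x :: t
  | w => w

end SturmianSqrt

open SturmianSqrt

namespace SturmianSqrt

/-! ### Coding the rotation around the fixed point of ψ -/

variable {α : ℝ}

/-! Write the intercept as x = u + 1 - α with u in (α - 1, α). The n-th letter then tells whether u
+ nα lies in [0, α) modulo 1, and ψ becomes u ↦ u / 2, with fixed point 0. Two points of (α - 1, α)
code the same word of length n exactly when no point j - iα with i < n separates them. Points
outside ℤα + ℤ never meet an interval end point, and every finite condition can be tested on them by
a small perturbation, so the convention plays no role.

All three conditions on a primitive w are compared with one geometric property: w² is read at some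
generic u, and no j - iα with 1 ≤ i < |w| lies strictly between 0 and u (`NoCrossing`). Then w is
read all the way from u to 0, in particular at u / 2.

(i) ⇒ (ii): the first j - nα strictly between 0 and u produces a square with root length n at u, so
a minimal square root has no crossing (`IsMinimalSquareRoot.noCrossing`). Halving therefore turns
each X_i² into X_i. Reading X_i² moves u by 2δ inside (α - 1, α), so the halved point moves by δ and
the argument continues with the next factor (`orbitWord_half_flatten`).

(ii) ⇒ no crossing: if some x separated 0 from u, iterating a contraction built from halving would
give points where w is read on the wrong side of x (`HalvingCondition.noCrossing`).

No crossing ⇒ (i): take the shortest square repeatedly. A return point between 0 and the current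
point guarantees that the next root fits in what remains of w (`exists_return_between`,
`exists_minimal_factorization`).

No crossing ⇔ (iii): w is then determined by its length and the side of 0 on which u lies.
Primitivity makes the displacement δ = |w|α - p a one-sided record of the sequence qα modulo 1, so
|w| is the length of a standard or semistandard word. Just beside 0, the points on one side read the
reversed words; those on the other side read reversed standard words with the first two letters
exchanged, because only the discontinuity at 0 itself is crossed (`NoCrossing.mem_reversed`,
`exists_noCrossing_of_mem_reversed`). -/

/-- The coding of the circle `ℝ / ℤ` that is `1` on `[0, α)` and `0` elsewhere. -/
noncomputable def arcCode (α v : ℝ) : Fin 2 := if Int.fract v < α then 1 else 0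

/-- The word of length `n` that codes the orbit of `u` under the rotation by `α`. -/
noncomputable def orbitWord (α u : ℝ) (n : ℕ) : Word :=
  (List.range n).map fun i : ℕ => arcCode α (u + i * α)

/-- The real number `u` does not belong to `ℤ α + ℤ`. -/
def Generic (α u : ℝ) : Prop := ∀ i j : ℤ, u ≠ i * α + j

@[simp] lemma length_orbitWord (u : ℝ) (n : ℕ) : (orbitWord α u n).length = n := by
  simp [orbitWord]

@[simp] lemma orbitWord_zero (u : ℝ) : orbitWord α u 0 = [] := rfl

lemma getElem_orbitWord (u : ℝ) (n i : ℕ) (h : i < (orbitWord α u n).length) :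
    (orbitWord α u n)[i] = arcCode α (u + i * α) := by
  simp [orbitWord]

lemma orbitWord_add (u : ℝ) (m n : ℕ) :
    orbitWord α u (m + n) = orbitWord α u m ++ orbitWord α (u + m * α) n := by
  simp only [orbitWord, List.range_add, List.map_append, List.map_map]
  congr 1
  apply List.map_congr_left
  intro i _
  simp only [Function.comp_apply]
  congr 1
  push_cast
  ring

lemma arcCode_add_int (v : ℝ) (j : ℤ) : arcCode α (v + j) = arcCode α v := by
  simp [arcCode]

lemma orbitWord_add_int (u : ℝ) (j : ℤ) (n : ℕ) : orbitWord α (u + j) n = orbitWord α u n := by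
  simp only [orbitWord]
  apply List.map_congr_left
  intro i _
  rw [← arcCode_add_int (u + i * α) j]
  congr 1
  ring

lemma orbitWord_eq_of_add_int {u v : ℝ} (j : ℤ) (h : v = u + j) (n : ℕ) :
    orbitWord α v n = orbitWord α u n := by
  rw [h, orbitWord_add_int]

lemma orbitWord_add_eq_append_iff (u : ℝ) {m n : ℕ} {x y : Word} (hx : x.length = m) :
    orbitWord α u (m + n) = x ++ y ↔ orbitWord α u m = x ∧ orbitWord α (u + m * α) n = y := by
  rw [orbitWord_add]
  constructor
  · intro h
    exact List.append_inj h (by simp [hx])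
  · rintro ⟨h1, h2⟩
    rw [h1, h2]

lemma orbitWord_prefix (u : ℝ) {m n : ℕ} (h : m ≤ n) : orbitWord α u m <+: orbitWord α u n := by
  obtain ⟨k, rfl⟩ := Nat.exists_eq_add_of_le h
  rw [orbitWord_add]
  exact List.prefix_append _ _

lemma orbitWord_eq_of_prefix {u : ℝ} {n : ℕ} {v : Word} (h : v <+: orbitWord α u n) :
    orbitWord α u v.length = v := by
  have hle : v.length ≤ n := by simpa using h.length_le
  have h2 := orbitWord_prefix (α := α) u hle
  exact (List.prefix_of_prefix_length_le h2 h (by simp)).eq_of_length (by simp)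

lemma orbitWord_eq_orbitWord_iff (u v : ℝ) (n : ℕ) :
    orbitWord α u n = orbitWord α v n ↔
      ∀ i < n, arcCode α (u + i * α) = arcCode α (v + i * α) := by
  simp [orbitWord]

lemma floor_sub_floor_eq_arcCode (h0 : 0 < α) (h1 : α < 1) (v : ℝ) :
    (((arcCode α v : Fin 2) : ℕ) : ℤ) = ⌊v⌋ - ⌊v - α⌋ := by
  have hf := Int.floor_add_fract v
  have hn := Int.fract_nonneg v
  have hl := Int.fract_lt_one v
  unfold arcCode
  split_ifs with h
  · have : ⌊v - α⌋ = ⌊v⌋ - 1 := by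
      rw [Int.floor_eq_iff]
      push_cast
      constructor <;> linarith
    rw [this]
    simp
  · have : ⌊v - α⌋ = ⌊v⌋ := by
      rw [Int.floor_eq_iff]
      constructor <;> linarith
    rw [this]
    simp

lemma floor_eq_floor_iff (a b : ℝ) : ⌊a⌋ = ⌊b⌋ ↔ ∀ j : ℤ, ((j : ℝ) ≤ a ↔ (j : ℝ) ≤ b) := by
  constructor
  · intro h j
    rw [← Int.le_floor, ← Int.le_floor, h]
  · intro h
    apply le_antisymm
    · rw [Int.le_floor]
      exact (h _).1 (Int.floor_le a)
    · rw [Int.le_floor]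
      exact (h _).2 (Int.floor_le b)

/-- Letter i is the increment ⌊u + iα⌋ - ⌊u + (i - 1)α⌋, so once the initial floors agree the words
and the floor sequences determine each other by telescoping. -/
lemma orbitWord_eq_iff_floor (h0 : 0 < α) (h1 : α < 1) {u v : ℝ} (huv : ⌊u - α⌋ = ⌊v - α⌋)
    (n : ℕ) : orbitWord α u n = orbitWord α v n ↔ ∀ i < n, ⌊u + i * α⌋ = ⌊v + i * α⌋ := by
  have key : ∀ i : ℕ, (u + (i + 1 : ℕ) * α) - α = u + i * α := fun i => by push_cast; ring
  have key' : ∀ i : ℕ, (v + (i + 1 : ℕ) * α) - α = v + i * α := fun i => by push_cast; ring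
  rw [orbitWord_eq_orbitWord_iff]
  have hval : ∀ x y : ℝ, arcCode α x = arcCode α y ↔ ⌊x⌋ - ⌊x - α⌋ = ⌊y⌋ - ⌊y - α⌋ := by
    intro x y
    rw [← floor_sub_floor_eq_arcCode h0 h1, ← floor_sub_floor_eq_arcCode h0 h1, Fin.ext_iff]
    norm_cast
  constructor
  · intro h i
    induction i with
    | zero =>
      intro hi
      have := (hval _ _).1 (h 0 hi)
      simp only [Nat.cast_zero, zero_mul, add_zero] at this ⊢
      linarith
    | succ i ih =>
      intro hi
      have h2 := (hval _ _).1 (h (i + 1) hi)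
      rw [key, key'] at h2
      have := ih (by omega)
      linarith
  · intro h i hi
    rw [hval]
    rcases i with _ | i
    · have := h 0 hi
      simp only [Nat.cast_zero, zero_mul, add_zero] at this ⊢
      linarith
    · rw [key, key', h _ hi, h i (by omega)]

lemma floor_sub_eq_neg_one {u : ℝ} (hu : u ∈ Ioo (α - 1) α) : ⌊u - α⌋ = -1 := by
  rw [Int.floor_eq_iff]
  push_cast
  constructor <;> linarith [hu.1, hu.2]

/-- Two points code the same word of length `n` if and only if no point of the backward orbit of
`0` separates them. -/
lemma orbitWord_eq_iff (h0 : 0 < α) (h1 : α < 1) {u v : ℝ} (hu : u ∈ Ioo (α - 1) α)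
    (hv : v ∈ Ioo (α - 1) α) (n : ℕ) :
    orbitWord α u n = orbitWord α v n ↔
      ∀ i < n, ∀ j : ℤ, ((j : ℝ) - i * α ≤ u ↔ (j : ℝ) - i * α ≤ v) := by
  rw [orbitWord_eq_iff_floor h0 h1 (by rw [floor_sub_eq_neg_one hu, floor_sub_eq_neg_one hv])]
  simp only [floor_eq_floor_iff, sub_le_iff_le_add]

/-- A point lying on the same side of u and of v cannot separate x from them: inside (α - 1, α) the
set of points reading a given word is convex. -/
lemma orbitWord_eq_of_mem_uIcc (h0 : 0 < α) (h1 : α < 1) {u v x : ℝ} {n : ℕ}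
    (hu : u ∈ Ioo (α - 1) α) (hv : v ∈ Ioo (α - 1) α) (hx : x ∈ uIcc u v)
    (h : orbitWord α u n = orbitWord α v n) : orbitWord α x n = orbitWord α u n := by
  have hx' : x ∈ Ioo (α - 1) α := ordConnected_Ioo.uIcc_subset hu hv hx
  rw [orbitWord_eq_iff h0 h1 hu hv] at h
  rw [orbitWord_eq_iff h0 h1 hx' hu]
  intro i hi j
  have := h i hi j
  rcases mem_uIcc.1 hx with ⟨h2, h3⟩ | ⟨h2, h3⟩
  · constructor
    · intro h4; exact this.2 (h4.trans h3)
    · intro h4; exact h4.trans h2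
  · constructor
    · intro h4; exact h4.trans h3
    · intro h4; exact (this.1 h4).trans h2

/-! ### Generic points -/

lemma Generic.add {u : ℝ} (hu : Generic α u) (i j : ℤ) : Generic α (u + i * α + j) := by
  intro a b h
  apply hu (a - i) (b - j)
  push_cast
  linarith

lemma Generic.of_eq {u v : ℝ} (hu : Generic α u) (i j : ℤ) (h : v = u + i * α + j) :
    Generic α v := h ▸ hu.add i j

lemma Generic.half {u : ℝ} (hu : Generic α u) : Generic α (u / 2) := by
  intro a b h
  apply hu (2 * a) (2 * b)
  push_cast
  linarith

lemma Generic.ne_zero {u : ℝ} (hu : Generic α u) : u ≠ 0 := by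
  have := hu 0 0
  simpa using this

lemma Generic.ne_sub {u : ℝ} (hu : Generic α u) (i : ℕ) (j : ℤ) : (j : ℝ) - i * α ≠ u := by
  have := hu (-i) j
  push_cast at this
  intro h
  apply this
  linarith

lemma exists_generic (α : ℝ) {a b : ℝ} (h : a < b) : ∃ u ∈ Ioo a b, Generic α u := by
  have hc : (range fun p : ℤ × ℤ => (p.1 : ℝ) * α + p.2).Countable := countable_range _
  obtain ⟨u, hu, hab⟩ := (hc.dense_compl ℝ).exists_between h
  refine ⟨u, hab, fun i j hij => hu ⟨(i, j), hij.symm⟩⟩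

/-- Every generic point has a representative modulo `1` in the interval `(α - 1, α)`. -/
lemma Generic.exists_representative {u : ℝ} (hu : Generic α u) :
    ∃ j : ℤ, u - j ∈ Ioo (α - 1) α ∧ Generic α (u - j) := by
  refine ⟨⌊u - α⌋ + 1, ⟨?_, ?_⟩, hu.of_eq 0 (-(⌊u - α⌋ + 1)) (by push_cast; ring)⟩
  · have h1 := Int.floor_le (u - α)
    have h2 : (⌊u - α⌋ : ℝ) ≠ u - α := fun h => hu 1 ⌊u - α⌋ (by push_cast; linarith)
    have h3 := lt_of_le_of_ne h1 h2
    push_cast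
    linarith
  · have := Int.lt_floor_add_one (u - α)
    push_cast
    linarith

lemma Generic.shift {u : ℝ} (hu : Generic α u) (n : ℕ) :
    ∃ j : ℤ, u + n * α - j ∈ Ioo (α - 1) α ∧ Generic α (u + n * α - j) :=
  Generic.exists_representative (hu.of_eq n 0 (by push_cast; ring))

/-! ### Words -/

@[simp] lemma wordPow_zero (u : Word) : wordPow u 0 = [] := rfl

lemma wordPow_succ (u : Word) (n : ℕ) : wordPow u (n + 1) = u ++ wordPow u n := by
  simp [wordPow, List.replicate_succ]

lemma wordPow_add (u : Word) (m n : ℕ) : wordPow u (m + n) = wordPow u m ++ wordPow u n := by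
  simp only [wordPow, List.replicate_add, List.flatten_append]

lemma wordPow_one (u : Word) : wordPow u 1 = u := by simp [wordPow]

lemma wordPow_succ' (u : Word) (n : ℕ) : wordPow u (n + 1) = wordPow u n ++ u := by
  rw [wordPow_add, wordPow_one]

lemma nil_wordPow (n : ℕ) : wordPow [] n = [] := by simp [wordPow]

lemma length_wordPow (u : Word) (n : ℕ) : (wordPow u n).length = n * u.length := by
  simp [wordPow]

lemma reverse_wordPow (u : Word) (n : ℕ) : (wordPow u n).reverse = wordPow u.reverse n := by
  induction n with
  | zero => rfl
  | succ n ih => rw [wordPow_succ, List.reverse_append, ih, wordPow_succ']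

lemma count_wordPow (x : Fin 2) (u : Word) (n : ℕ) :
    (wordPow u n).count x = n * u.count x := by
  induction n with
  | zero => simp
  | succ n ih => rw [wordPow_succ, List.count_append, ih]; ring

@[simp] lemma length_sq (w : Word) : (sq w).length = w.length + w.length := by simp [sq]

lemma IsPrimitive.ne_nil {w : Word} (hw : IsPrimitive w) : w ≠ [] := by
  rintro rfl
  exact absurd (hw [] 0 rfl) (by norm_num)

/-- Commuting words are powers of a common word. -/
lemma exists_wordPow_of_commute (x y : Word) (h : x ++ y = y ++ x) :
    ∃ z m n, x = wordPow z m ∧ y = wordPow z n := by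
  induction hk : x.length + y.length using Nat.strong_induction_on generalizing x y with
  | _ k ih =>
    rcases eq_or_ne x [] with rfl | hx
    · exact ⟨y, 0, 1, rfl, (wordPow_one y).symm⟩
    rcases eq_or_ne y [] with rfl | hy
    · exact ⟨x, 1, 0, (wordPow_one x).symm, rfl⟩
    have hx' := List.length_pos_iff.2 hx
    have hy' := List.length_pos_iff.2 hy
    rcases le_total x.length y.length with hl | hl
    · obtain ⟨t, rfl⟩ : x <+: y :=
        List.prefix_of_prefix_length_le (h ▸ List.prefix_append x y) (List.prefix_append y x) hl
      have h2 : x ++ t = t ++ x := by simpa using h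
      obtain ⟨z, m, n, h3, h4⟩ := ih (x.length + t.length)
        (by simp only [List.length_append] at hk; omega) x t h2 rfl
      exact ⟨z, m, m + n, h3, by rw [wordPow_add, ← h3, ← h4]⟩
    · obtain ⟨t, rfl⟩ : y <+: x :=
        List.prefix_of_prefix_length_le (h ▸ List.prefix_append y x) (List.prefix_append x y) hl
      have h2 : t ++ y = y ++ t := by simpa using h
      obtain ⟨z, m, n, h3, h4⟩ := ih (t.length + y.length)
        (by simp only [List.length_append] at hk; omega) t y h2 rfl
      exact ⟨z, n + m, n, by rw [wordPow_add, ← h3, ← h4], h4⟩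

/-- A primitive word occurs in its square only as a prefix and as a suffix. -/
lemma IsPrimitive.not_internal_factor {w a b : Word} (hw : IsPrimitive w)
    (h : w ++ w = a ++ (w ++ b)) (ha : a ≠ []) (hl : a.length < w.length) : False := by
  obtain ⟨y, rfl⟩ : a <+: w :=
    List.prefix_of_prefix_length_le (h ▸ List.prefix_append a _) (List.prefix_append w w) hl.le
  have h2 : y ++ a ++ y = (a ++ y) ++ b := by simpa using h
  -- An internal occurrence makes the two parts of w = ay commute, hence powers of a common word.
  have h3 : y ++ a = a ++ y := (List.append_inj h2 (by simp [add_comm])).1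
  obtain ⟨z, m, n, h4, h5⟩ := exists_wordPow_of_commute a y h3.symm
  have h6 := hw z (m + n) (by rw [wordPow_add, ← h4, ← h5])
  have hy : y ≠ [] := by rintro rfl; simp at hl
  rcases m with _ | m
  · exact ha (by simpa using h4)
  rcases n with _ | n
  · exact hy (by simpa using h5)
  omega

lemma IsMinimalSquareRoot.isPrimitive {w : Word} (hw : IsMinimalSquareRoot w) :
    IsPrimitive w := by
  rintro z n rfl
  have hne := hw.1
  rcases n with _ | _ | n
  · exact absurd rfl hne
  · rfl
  exfalso
  have hz : z ≠ [] := by rintro rfl; exact hne (nil_wordPow _)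
  have hz' := List.length_pos_iff.2 hz
  have hpre : sq z <+: sq (wordPow z (n + 1 + 1)) := by
    refine ⟨wordPow z n ++ wordPow z (n + 2), ?_⟩
    simp [sq, wordPow_succ]
  have := congrArg List.length (hw.2 z hz hpre)
  rw [length_sq, length_sq, length_wordPow] at this
  nlinarith

/-! ### Squares in the orbit words -/

/-- The orbit word of `u` begins with the square of `w`. -/
def SquareAt (α u : ℝ) (w : Word) : Prop := orbitWord α u (w.length + w.length) = w ++ w

lemma squareAt_iff {u : ℝ} {w : Word} : SquareAt α u w ↔
    orbitWord α u w.length = w ∧ orbitWord α (u + w.length * α) w.length = w :=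
  orbitWord_add_eq_append_iff u rfl

lemma SquareAt.of_shift {u δ : ℝ} {w : Word} (p : ℤ) (hδ : δ = w.length * α - p)
    (h1 : orbitWord α u w.length = w) (h2 : orbitWord α (u + δ) w.length = w) :
    SquareAt α u w :=
  squareAt_iff.2 ⟨h1, by rw [orbitWord_eq_of_add_int p _, h2]; rw [hδ]; ring⟩

/-- Here δ is the real displacement of u caused by reading one copy of w, normalised so that u + δ
returns to the fundamental domain, where words can be compared by order. -/
lemma SquareAt.exists_shift {u : ℝ} {w : Word} (hu : Generic α u) (h : SquareAt α u w) :
    ∃ (δ : ℝ) (p : ℤ), δ = w.length * α - p ∧ u + δ ∈ Ioo (α - 1) α ∧ Generic α (u + δ) ∧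
      orbitWord α u w.length = w ∧ orbitWord α (u + δ) w.length = w := by
  obtain ⟨h1, h2⟩ := squareAt_iff.1 h
  obtain ⟨p, hp, hg⟩ := hu.shift w.length
  have e : u + w.length * α - p = u + (w.length * α - p) := by ring
  refine ⟨w.length * α - p, p, rfl, e ▸ hp, e ▸ hg, h1, ?_⟩
  rw [← e, ← orbitWord_eq_of_add_int p (u := u + w.length * α - p) (v := u + w.length * α)
    (by ring), h2]

lemma nonneg_iff_of_orbitWord_eq (h0 : 0 < α) (h1 : α < 1) {u v : ℝ} (hu : u ∈ Ioo (α - 1) α)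
    (hv : v ∈ Ioo (α - 1) α) {n : ℕ} (hn : 0 < n) (h : orbitWord α u n = orbitWord α v n) :
    0 ≤ u ↔ 0 ≤ v := by
  simpa using (orbitWord_eq_iff h0 h1 hu hv n).1 h 0 hn 0

lemma SquareAt.not_internal {u : ℝ} {w : Word} (hw : IsPrimitive w) (h : SquareAt α u w) {i : ℕ}
    (hi : 1 ≤ i) (hiw : i < w.length) : orbitWord α (u + i * α) w.length ≠ w := by
  intro h2
  have e : w.length + w.length = i + (w.length + (w.length - i)) := by omega
  unfold SquareAt at h
  rw [e, orbitWord_add, orbitWord_add, h2] at h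
  refine hw.not_internal_factor h.symm ?_ (by simpa using hiw)
  intro h3
  have := congrArg List.length h3
  simp at this
  omega

/-- If the square of a primitive word `w` shifts the point `u` by `δ`, then no shorter orbit piece
shifts by an amount between `0` and `δ`. -/
lemma SquareAt.not_mem_uIcc (h0 : 0 < α) (h1 : α < 1) {u δ : ℝ} {w : Word} (hw : IsPrimitive w)
    (h : SquareAt α u w) (hu : u ∈ Ioo (α - 1) α) (hv : u + δ ∈ Ioo (α - 1) α)
    (h2 : orbitWord α (u + δ) w.length = w) {i : ℕ} (hi : 1 ≤ i) (hiw : i < w.length) (j : ℤ) :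
    (i * α - j : ℝ) ∉ uIcc 0 δ := by
  intro hmem
  have h3 := (squareAt_iff.1 h).1
  apply h.not_internal hw hi hiw
  rw [orbitWord_eq_of_add_int j (u := u + (i * α - j)) (by ring)]
  -- The point u + (iα - j) lies between u and u + δ, which both read w; so w would occur inside w²
  -- at position i.
  rw [orbitWord_eq_of_mem_uIcc h0 h1 hu hv _ (h3.trans h2.symm), h3]
  rcases mem_uIcc.1 hmem with ⟨h4, h5⟩ | ⟨h4, h5⟩
  · exact mem_uIcc.2 (Or.inl ⟨by linarith, by linarith⟩)
  · exact mem_uIcc.2 (Or.inr ⟨by linarith, by linarith⟩)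

/-! ### Words read all the way to zero -/

/-- No point `j - i α` with `1 ≤ i < n` lies strictly between `0` and `u`. -/
def NoCrossing (α u : ℝ) (n : ℕ) : Prop :=
  ∀ i : ℕ, 1 ≤ i → i < n → ∀ j : ℤ,
    (0 < (j - i * α : ℝ) → (j - i * α : ℝ) < u → False) ∧
    (u < (j - i * α : ℝ) → (j - i * α : ℝ) < 0 → False)

lemma NoCrossing.mono {u : ℝ} {m n : ℕ} (h : NoCrossing α u n) (hmn : m ≤ n) :
    NoCrossing α u m :=
  fun i hi him j => h i hi (him.trans_le hmn) j

lemma NoCrossing.of_orbitWord_eq (h0 : 0 < α) (h1 : α < 1) {u v : ℝ} {n : ℕ}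
    (hu : u ∈ Ioo (α - 1) α) (hv : v ∈ Ioo (α - 1) α) (hgu : Generic α u)
    (h : NoCrossing α u n) (he : orbitWord α u n = orbitWord α v n) : NoCrossing α v n := by
  intro i hi hin j
  have h2 := (orbitWord_eq_iff h0 h1 hu hv n).1 he i hin j
  constructor
  · intro h3 h4
    exact (h i hi hin j).1 h3 (lt_of_le_of_ne (h2.2 h4.le) (hgu.ne_sub i j))
  · intro h3 h4
    refine (h i hi hin j).2 ?_ h4
    by_contra h5
    exact absurd (h2.1 (not_lt.1 h5)) (not_le.2 h3)

/-- If nothing crosses between `0` and `u`, the points between `0` and `u` code the same word. -/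
lemma NoCrossing.orbitWord_eq (h0 : 0 < α) (h1 : α < 1) {u v : ℝ} {n : ℕ}
    (hu : u ∈ Ioo (α - 1) α) (hgu : Generic α u) (h : NoCrossing α u n)
    (hv : 0 < v ∧ v ≤ u ∨ u ≤ v ∧ v < 0) : orbitWord α v n = orbitWord α u n := by
  have hv' : v ∈ Ioo (α - 1) α := by
    rcases hv with h2 | h2 <;> constructor <;> linarith [hu.1, hu.2]
  rw [orbitWord_eq_iff h0 h1 hv' hu]
  intro i hi j
  -- The index i = 0 is exempt from `NoCrossing`; there the separating points are integers, and 0 is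
  -- the only one in (α - 1, α).
  rcases Nat.eq_zero_or_pos i with rfl | hi0
  · simp only [Nat.cast_zero, zero_mul, sub_zero]
    have hj : (j : ℝ) ≤ u ∨ (j : ℝ) ≤ v → j < 1 := by
      intro h5
      have : (j : ℝ) < 1 := by rcases h5 with h5 | h5 <;> linarith [hu.2, hv'.2]
      exact_mod_cast this
    have hj2 : j < 1 → (j : ℝ) ≤ 0 := fun h5 => by exact_mod_cast Int.lt_add_one_iff.1 h5
    have hj3 : (j : ℝ) ≤ 0 → j ≠ 0 → (j : ℝ) ≤ -1 := by
      intro h5 h6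
      have h7 : j ≤ 0 := by exact_mod_cast h5
      have : j ≤ -1 := by omega
      exact_mod_cast this
    rcases hv with ⟨h2, h3⟩ | ⟨h2, h3⟩
    · constructor
      · intro h4; linarith
      · intro h4; linarith [hj2 (hj (Or.inl h4))]
    · constructor
      · intro h4
        have h5 := hj2 (hj (Or.inr h4))
        rcases eq_or_ne j 0 with rfl | h6
        · simp at h4; linarith
        · linarith [hj3 h5 h6, hu.1]
      · intro h4; linarith
  · have h2 := h i hi0 hi j
    have h3 := hgu.ne_sub i j
    constructor
    · intro h4
      by_contra h5
      rcases hv with h6 | h6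
      · linarith
      · exact h2.2 (not_le.1 h5) (by linarith)
    · intro h4
      by_contra h5
      rcases hv with h6 | h6
      · exact h2.1 (by linarith) (lt_of_le_of_ne h4 h3)
      · linarith

lemma NoCrossing.orbitWord_half (h0 : 0 < α) (h1 : α < 1) {u : ℝ} {n : ℕ}
    (hu : u ∈ Ioo (α - 1) α) (hgu : Generic α u) (h : NoCrossing α u n) :
    orbitWord α (u / 2) n = orbitWord α u n := by
  apply h.orbitWord_eq h0 h1 hu hgu
  rcases lt_or_gt_of_ne hgu.ne_zero with h2 | h2
  · right; constructor <;> linarith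
  · left; constructor <;> linarith

lemma half_mem_Ioo (h0 : 0 < α) (h1 : α < 1) {u : ℝ} (hu : u ∈ Ioo (α - 1) α) :
    u / 2 ∈ Ioo (α - 1) α := by
  constructor <;> linarith [hu.1, hu.2]

/-! ### Continued fraction remainders -/

/-- The distances `|q_{k-1} α - p_{k-1}|` of the convergents of `α`. -/
noncomputable def remainder (α : ℝ) : ℕ → ℝ
  | 0 => 1
  | 1 => α
  | k + 2 => remainder α k - partialQuotient α (k + 1) * remainder α (k + 1)

@[simp] lemma remainder_zero : remainder α 0 = 1 := rfl

@[simp] lemma remainder_one : remainder α 1 = α := rfl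

lemma remainder_add_two (k : ℕ) : remainder α (k + 2) =
    remainder α k - partialQuotient α (k + 1) * remainder α (k + 1) := by
  rw [remainder]

/-- The recursion r_k = a r_{k+1} + r_{k+2}, divided by r_{k+1}, splits the reciprocal of r_{k+1} /
r_k into integer and fractional parts. So the ratios are the iterates of the Gauss map, and
irrationality keeps them nonzero. -/
lemma remainder_aux (hα : Irrational α) (h0 : 0 < α) (h1 : α < 1) (k : ℕ) :
    0 < remainder α (k + 1) ∧ remainder α (k + 1) < remainder α k ∧
      Irrational (remainder α (k + 1) / remainder α k) ∧
      ∃ b, GenContFract.IntFractPair.stream α k =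
        some ⟨b, remainder α (k + 1) / remainder α k⟩ := by
  induction k with
  | zero =>
    refine ⟨h0, h1, by simpa using hα, ⌊α⌋, ?_⟩
    rw [GenContFract.IntFractPair.stream_zero, GenContFract.IntFractPair.of]
    simp [Int.fract_eq_self.2 ⟨h0.le, h1⟩]
  | succ k ih =>
    obtain ⟨hpos, hlt, hirr, b, hb⟩ := ih
    set r := remainder α (k + 1) / remainder α k with hr
    have hk : 0 < remainder α k := hpos.trans hlt
    have hr0 : 0 < r := div_pos hpos hk
    have hs := GenContFract.IntFractPair.stream_succ_of_some hb hr0.ne'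
    simp only [GenContFract.IntFractPair.of] at hs
    have hfl : 0 ≤ ⌊r⁻¹⌋ := Int.floor_nonneg.2 (inv_pos.2 hr0).le
    have ha : (partialQuotient α (k + 1) : ℝ) = (⌊r⁻¹⌋ : ℝ) := by
      have h2 : ((partialQuotient α (k + 1) : ℕ) : ℤ) = ⌊r⁻¹⌋ := by
        rw [partialQuotient, hs]
        simpa using hfl
      exact_mod_cast h2
    have hinv : r⁻¹ = remainder α k / remainder α (k + 1) := by rw [hr, inv_div]
    have hfr : remainder α (k + 2) / remainder α (k + 1) = Int.fract r⁻¹ := by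
      rw [Int.fract, ← ha, remainder_add_two, hinv]
      field_simp
    have hirr' : Irrational (Int.fract r⁻¹) := by
      rw [Int.fract]
      exact (irrational_inv_iff.2 hirr).sub_intCast _
    have hfr0 : 0 < Int.fract r⁻¹ :=
      lt_of_le_of_ne (Int.fract_nonneg _) (fun h => hirr'.ne_zero h.symm)
    refine ⟨?_, ?_, ?_, ⌊r⁻¹⌋, ?_⟩
    · rw [← hfr] at hfr0
      exact (div_pos_iff_of_pos_right hpos).1 hfr0
    · have := Int.fract_lt_one r⁻¹
      rw [← hfr, div_lt_one hpos] at this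
      exact this
    · rw [show k + 1 + 1 = k + 2 from rfl, hfr]
      exact hirr'
    · rw [hs, show k + 1 + 1 = k + 2 from rfl, hfr]

lemma remainder_pos (hα : Irrational α) (h0 : 0 < α) (h1 : α < 1) (k : ℕ) :
    0 < remainder α k := by
  rcases k with _ | k
  · exact one_pos
  · exact (remainder_aux hα h0 h1 k).1

lemma remainder_succ_lt (hα : Irrational α) (h0 : 0 < α) (h1 : α < 1) (k : ℕ) :
    remainder α (k + 1) < remainder α k := (remainder_aux hα h0 h1 k).2.1

lemma one_le_partialQuotient (hα : Irrational α) (h0 : 0 < α) (h1 : α < 1) (k : ℕ) :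
    1 ≤ partialQuotient α (k + 1) := by
  have h := remainder_add_two (α := α) k
  have h2 := remainder_succ_lt hα h0 h1 k
  have h3 := remainder_succ_lt hα h0 h1 (k + 1)
  by_contra hlt
  have h4 : partialQuotient α (k + 1) = 0 := by omega
  rw [h4] at h
  simp at h
  linarith

lemma remainder_add_two_lt_half (hα : Irrational α) (h0 : 0 < α) (h1 : α < 1) (k : ℕ) :
    remainder α (k + 2) < remainder α k / 2 := by
  have h := remainder_add_two (α := α) k
  have h2 := remainder_succ_lt hα h0 h1 (k + 1)
  have h3 : (1 : ℝ) ≤ partialQuotient α (k + 1) := by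
    exact_mod_cast one_le_partialQuotient hα h0 h1 k
  have h4 := remainder_pos hα h0 h1 (k + 1)
  nlinarith

/-! ### Lengths and heights of the standard words -/

/-- The length of the `k`-th standard word. -/
noncomputable def convLength (α : ℝ) (k : ℕ) : ℕ := (standardWord α k).length

/-- The number of letters `1` of the `k`-th standard word. -/
noncomputable def convHeight (α : ℝ) (k : ℕ) : ℕ := (standardWord α k).count 1

lemma convLength_zero : convLength α 0 = 1 := by simp [convLength, standardWord]

lemma convHeight_zero : convHeight α 0 = 0 := by simp [convHeight, standardWord]

lemma convLength_one (ha : 1 ≤ partialQuotient α 1) :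
    convLength α 1 = partialQuotient α 1 := by
  simp only [convLength, standardWord, List.length_append, length_wordPow, List.length_singleton]
  omega

lemma convHeight_one : convHeight α 1 = 1 := by
  simp [convHeight, standardWord, count_wordPow]

lemma length_semistandardWord (k l : ℕ) :
    (semistandardWord α k l).length = l * convLength α (k + 1) + convLength α k := by
  simp [semistandardWord, length_wordPow, convLength]

lemma count_semistandardWord (k l : ℕ) :
    (semistandardWord α k l).count 1 = l * convHeight α (k + 1) + convHeight α k := by
  simp [semistandardWord, count_wordPow, convHeight]

lemma standardWord_add_two (k : ℕ) :
    standardWord α (k + 2) = semistandardWord α k (partialQuotient α (k + 2)) := by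
  rw [standardWord, semistandardWord]

lemma semistandardWord_zero (k : ℕ) : semistandardWord α k 0 = standardWord α k := rfl

lemma convLength_add_two (k : ℕ) : convLength α (k + 2) =
    partialQuotient α (k + 2) * convLength α (k + 1) + convLength α k := by
  rw [convLength, standardWord_add_two, length_semistandardWord]

lemma convHeight_add_two (k : ℕ) : convHeight α (k + 2) =
    partialQuotient α (k + 2) * convHeight α (k + 1) + convHeight α k := by
  rw [convHeight, standardWord_add_two, count_semistandardWord]

lemma convLength_mul_sub (ha : 1 ≤ partialQuotient α 1) (k : ℕ) :
    convLength α k * α - convHeight α k = (-1) ^ k * remainder α (k + 1) := by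
  induction k using Nat.twoStepInduction with
  | zero => simp [convLength_zero, convHeight_zero]
  | one =>
    rw [convLength_one ha, convHeight_one, remainder_add_two]
    simp
  | more k h1 h2 =>
    rw [convLength_add_two, convHeight_add_two, remainder_add_two]
    push_cast
    linear_combination (partialQuotient α (k + 2) : ℝ) * h2 + h1

lemma convLength_det (k : ℕ) :
    (convLength α (k + 1) * convHeight α k - convHeight α (k + 1) * convLength α k : ℤ)
      = (-1) ^ (k + 1) := by
  induction k with
  | zero => simp [convLength_zero, convHeight_zero, convHeight_one]
  | succ k ih =>
    rw [convLength_add_two, convHeight_add_two, pow_succ, ← ih]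
    push_cast
    ring

lemma convLength_pos (k : ℕ) : 0 < convLength α k := by
  induction k using Nat.twoStepInduction with
  | zero => simp [convLength_zero]
  | one => simp [convLength, standardWord]
  | more k h1 _ => rw [convLength_add_two]; omega

lemma convLength_lt_succ (hα : Irrational α) (h0 : 0 < α) (h1 : α < 1)
    (ha : 2 ≤ partialQuotient α 1) (k : ℕ) : convLength α k < convLength α (k + 1) := by
  rcases k with _ | k
  · rw [convLength_zero, convLength_one (by omega)]
    omega
  · rw [convLength_add_two]
    have h2 := one_le_partialQuotient hα h0 h1 (k + 1)
    have h3 := convLength_pos (α := α) k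
    nlinarith [convLength_pos (α := α) (k + 1)]

lemma two_le_partialQuotient_one (hα : Irrational α) (h0 : 0 < α) (h2 : α < 1 / 2) :
    2 ≤ partialQuotient α 1 := by
  have h := remainder_add_two (α := α) 0
  have h3 := remainder_succ_lt hα h0 (by linarith) 1
  simp only [remainder_zero, zero_add, remainder_one] at h h3
  by_contra hlt
  have h4 : (partialQuotient α 1 : ℝ) ≤ 1 := by exact_mod_cast (by omega : partialQuotient α 1 ≤ 1)
  simp only [Nat.reduceAdd] at h3
  nlinarith

/-! ### Approximation -/

lemma exists_remainder_lt (hα : Irrational α) (h0 : 0 < α) (h1 : α < 1) {ε : ℝ} (hε : 0 < ε)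
    (k : ℕ) : ∃ m, remainder α (2 * m + k) < ε := by
  have hk : ∀ m, remainder α (2 * m + k) ≤ (1 / 2) ^ m := by
    intro m
    induction m with
    | zero =>
      have : ∀ k, remainder α k ≤ 1 := by
        intro k
        induction k with
        | zero => simp
        | succ k ih => exact (remainder_succ_lt hα h0 h1 k).le.trans ih
      simpa using this k
    | succ m ih =>
      have := remainder_add_two_lt_half hα h0 h1 (2 * m + k)
      rw [show 2 * (m + 1) + k = 2 * m + k + 2 by ring, pow_succ]
      linarith
  obtain ⟨m, hm⟩ := exists_pow_lt_of_lt_one hε (by norm_num : (1 / 2 : ℝ) < 1)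
  exact ⟨m, (hk m).trans_lt hm⟩

/-- The backward orbit of `0` enters each interval with end point `0`. -/
lemma exists_backward_between (hα : Irrational α) (h0 : 0 < α) (h1 : α < 1) {u : ℝ}
    (hu : u ≠ 0) : ∃ n : ℕ, 1 ≤ n ∧ ∃ j : ℤ,
      (0 < (j - n * α : ℝ) ∧ (j - n * α : ℝ) < u) ∨ (u < (j - n * α : ℝ) ∧ (j - n * α : ℝ) < 0) := by
  have ha := one_le_partialQuotient hα h0 h1 0
  -- The points p_k - q_kα approach 0 from below for even k and from above for odd k.
  rcases lt_or_gt_of_ne hu with hu | hu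
  · obtain ⟨m, hm⟩ := exists_remainder_lt hα h0 h1 (neg_pos.2 hu) 1
    have h2 := convLength_mul_sub ha (2 * m)
    have h3 := remainder_pos hα h0 h1 (2 * m + 1)
    rw [pow_mul] at h2
    simp only [even_two, Even.neg_pow, one_pow, one_mul] at h2
    refine ⟨convLength α (2 * m), convLength_pos _, convHeight α (2 * m), Or.inr ?_⟩
    push_cast
    constructor <;> linarith
  · obtain ⟨m, hm⟩ := exists_remainder_lt hα h0 h1 hu 2
    have h2 := convLength_mul_sub ha (2 * m + 1)
    have h3 := remainder_pos hα h0 h1 (2 * m + 2)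
    rw [pow_succ, pow_mul] at h2
    simp only [even_two, Even.neg_pow, one_pow, one_mul, neg_mul] at h2
    refine ⟨convLength α (2 * m + 1), convLength_pos _, convHeight α (2 * m + 1), Or.inl ?_⟩
    push_cast
    constructor <;> linarith

/-! ### Squares with no crossing -/

/-- If `u` starts with the square of the primitive word `w` of length `q`, and `R^q` moves `u` to
`u + δ`, then moving twice stays in the fundamental domain `(α - 1, α)`. -/
lemma add_two_mul_shift_mem (h0 : 0 < α) (h2 : α < 1 / 2) {u δ : ℝ} {w : Word} {p : ℤ}
    (hw : IsPrimitive w) (hu : u ∈ Ioo (α - 1) α) (hgu : Generic α u) (hs : SquareAt α u w)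
    (hN : NoCrossing α u w.length) (hδ : δ = w.length * α - p) (hv : u + δ ∈ Ioo (α - 1) α)
    (hgv : Generic α (u + δ)) (hwv : orbitWord α (u + δ) w.length = w) :
    u + 2 * δ ∈ Ioo (α - 1) α := by
  have h1 : α < 1 := by linarith
  have hq := List.length_pos_iff.2 hw.ne_nil
  have hwu := (squareAt_iff.1 hs).1
  have hN' : NoCrossing α (u + δ) w.length :=
    hN.of_orbitWord_eq h0 h1 hu hv hgu (hwu.trans hwv.symm)
  have hsign := nonneg_iff_of_orbitWord_eq h0 h1 hu hv hq (hwu.trans hwv.symm)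
  have hq1 : w.length = 1 ∨ 2 ≤ w.length := by omega
  have hu0 := hgu.ne_zero
  have hv0 := hgv.ne_zero
  have hlen1 : w.length = 1 → δ = α - p := fun h => by rw [hδ, h]; simp
  rcases lt_or_gt_of_ne hu0 with hneg | hpos
  · have hneg' : u + δ < 0 := by
      by_contra h
      exact absurd (hsign.2 (not_lt.1 h)) (not_le.2 hneg)
    rcases le_total 0 δ with hd | hd
    · refine ⟨by linarith [hu.1], ?_⟩
      rcases hq1 with hq1 | hq1
      · have h3 := hlen1 hq1
        have h4 : (-1 : ℝ) < p := by linarith [hu.1]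
        have h4' : (-1 : ℤ) < p := by exact_mod_cast h4
        have h5 : (0 : ℝ) ≤ p := by exact_mod_cast (by omega : 0 ≤ p)
        linarith
      · have h3 := hs.not_mem_uIcc h0 h1 hw hu hv hwv le_rfl (by omega) 0
        have h4 : δ < α := by
          by_contra h4
          apply h3
          rw [mem_uIcc]
          left
          constructor <;> push_cast <;> linarith
        linarith
    · refine ⟨?_, by linarith [hu.2]⟩
      by_contra hcon
      -- In length 1 only δ = α - p is available. In greater length the index |w| - 1 is admissible,
      -- and its point (p - 1) - (|w| - 1)α = α - 1 - δ would cross between u + δ and 0 if u + 2δ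
      -- left the domain. On the positive side, α - δ plays the same part.
      rcases hq1 with hq1 | hq1
      · have h3 := hlen1 hq1
        have h4 : (0 : ℝ) < p := by linarith
        have h4' : (0 : ℤ) < p := by exact_mod_cast h4
        have h5 : (1 : ℝ) ≤ p := by exact_mod_cast (by omega : 1 ≤ p)
        linarith [hv.1]
      · have hc : ((w.length - 1 : ℕ) : ℝ) = w.length - 1 := by
          rw [Nat.cast_sub (by omega)]; simp
        have h3 := hgv.ne_sub (w.length - 1) (p - 1)
        have h4 := (hN' (w.length - 1) (by omega) (by omega) (p - 1)).2
        rw [hc] at h3 h4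
        push_cast at h3 h4
        exact h4 (lt_of_le_of_ne (by linarith) (Ne.symm h3)) (by linarith [hv.1])
  · have hpos' : 0 < u + δ := lt_of_le_of_ne (hsign.1 hpos.le) (Ne.symm hv0)
    rcases le_total δ 0 with hd | hd
    · constructor <;> linarith [hu.1, hu.2]
    · refine ⟨by linarith [hu.1], ?_⟩
      by_contra hcon
      rcases hq1 with hq1 | hq1
      · have h3 := hlen1 hq1
        have h4 : (p : ℝ) < 1 := by linarith
        have h4' : p < 1 := by exact_mod_cast h4
        have h5 : (p : ℝ) ≤ 0 := by exact_mod_cast (by omega : p ≤ 0)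
        linarith [hv.2]
      · have hc : ((w.length - 1 : ℕ) : ℝ) = w.length - 1 := by
          rw [Nat.cast_sub (by omega)]; simp
        have h3 := hgv.ne_sub (w.length - 1) p
        have h4 := (hN' (w.length - 1) (by omega) (by omega) p).1
        rw [hc] at h3 h4
        exact h4 (by linarith [hv.2]) (lt_of_le_of_ne (by linarith) h3)

/-- A return `R^n u` strictly between `0` and `u` with `n` minimal gives a square. -/
lemma exists_squareAt_noCrossing_le (h0 : 0 < α) (h1 : α < 1) {u : ℝ} (hu : u ∈ Ioo (α - 1) α)
    (hgu : Generic α u) {m : ℕ} (hm : 1 ≤ m) {j : ℤ}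
    (hj : (0 < (j - m * α : ℝ) ∧ (j - m * α : ℝ) < u) ∨
      (u < (j - m * α : ℝ) ∧ (j - m * α : ℝ) < 0)) :
    ∃ n, 1 ≤ n ∧ n ≤ m ∧ SquareAt α u (orbitWord α u n) ∧ NoCrossing α u n := by
  classical
  have hex : ∃ n : ℕ, 1 ≤ n ∧ ∃ j : ℤ,
      (0 < (j - n * α : ℝ) ∧ (j - n * α : ℝ) < u) ∨
      (u < (j - n * α : ℝ) ∧ (j - n * α : ℝ) < 0) := ⟨m, hm, j, hj⟩
  obtain ⟨hn, j', hj'⟩ := Nat.find_spec hex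
  have hmin := fun k (hk : k < Nat.find hex) => Nat.find_min hex hk
  have hle : Nat.find hex ≤ m := Nat.find_min' hex ⟨hm, j, hj⟩
  generalize Nat.find hex = n at *
  have hN : NoCrossing α u n := by
    intro i hi hin j
    exact ⟨fun h3 h4 => hmin i hin ⟨hi, j, Or.inl ⟨h3, h4⟩⟩,
      fun h3 h4 => hmin i hin ⟨hi, j, Or.inr ⟨h3, h4⟩⟩⟩
  -- With x = j' - nα the first crossing, u - x also lies strictly between 0 and u, and since
  -- nothing crossed earlier it reads the same n letters as u.
  refine ⟨n, hn, hle, SquareAt.of_shift (δ := n * α - j') j' (by simp) (by simp) ?_, hN⟩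
  rw [length_orbitWord]
  apply hN.orbitWord_eq h0 h1 hu hgu
  rcases hj' with ⟨h3, h4⟩ | ⟨h3, h4⟩
  · left; constructor <;> linarith
  · right; constructor <;> linarith

lemma IsMinimalSquareRoot.length_le {u : ℝ} {w : Word} (hw : IsMinimalSquareRoot w)
    (hs : SquareAt α u w) {n : ℕ} (hn : 1 ≤ n) (hsn : SquareAt α u (orbitWord α u n)) :
    w.length ≤ n := by
  by_contra hlt
  have hne : orbitWord α u n ≠ [] := by
    intro h
    have := congrArg List.length h
    simp at this
    omega
  have hpre : sq (orbitWord α u n) <+: sq w := by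
    unfold SquareAt at hs hsn
    rw [sq, sq, ← hs, ← hsn]
    apply orbitWord_prefix
    rw [length_orbitWord]
    omega
  have := congrArg List.length (hw.2 _ hne hpre)
  simp at this
  omega

/-- The backward orbit of 0 accumulates at 0 from both sides, so some point enters between 0 and u.
The first one to do so yields a square at u, whose root is at least as long as w. -/
lemma IsMinimalSquareRoot.noCrossing (hα : Irrational α) (h0 : 0 < α) (h1 : α < 1) {u : ℝ}
    (hu : u ∈ Ioo (α - 1) α) (hgu : Generic α u) {w : Word} (hw : IsMinimalSquareRoot w)
    (hs : SquareAt α u w) : NoCrossing α u w.length := by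
  obtain ⟨m, hm, j, hj⟩ := exists_backward_between hα h0 h1 hgu.ne_zero
  obtain ⟨n, hn, -, hsn, hN⟩ := exists_squareAt_noCrossing_le h0 h1 hu hgu hm hj
  exact hN.mono (hw.length_le hs hn hsn)

lemma exists_isMinimalSquareRoot_le {u : ℝ} {n : ℕ} (hn : 1 ≤ n)
    (hs : SquareAt α u (orbitWord α u n)) :
    ∃ m, 1 ≤ m ∧ m ≤ n ∧ IsMinimalSquareRoot (orbitWord α u m) ∧
      SquareAt α u (orbitWord α u m) := by
  classical
  have hex : ∃ n, 1 ≤ n ∧ SquareAt α u (orbitWord α u n) := ⟨n, hn, hs⟩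
  obtain ⟨h1, h2⟩ := Nat.find_spec hex
  have hmin := fun k (hk : k < Nat.find hex) => Nat.find_min hex hk
  have hle : Nat.find hex ≤ n := Nat.find_min' hex ⟨hn, hs⟩
  generalize Nat.find hex = m at *
  refine ⟨m, h1, hle, ⟨?_, ?_⟩, h2⟩
  · intro h
    have := congrArg List.length h
    simp at this
    omega
  · intro v hv hpre
    have hv' := List.length_pos_iff.2 hv
    have h2' : orbitWord α u (m + m) = orbitWord α u m ++ orbitWord α u m := by
      simpa [SquareAt] using h2
    rw [sq, sq, ← h2'] at hpre
    have h3 := orbitWord_eq_of_prefix hpre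
    have h4 : orbitWord α u v.length = v :=
      orbitWord_eq_of_prefix ((List.prefix_append v v).trans hpre)
    have h5 : m ≤ v.length := by
      by_contra hlt
      exact hmin _ (not_le.1 hlt) ⟨hv', by rw [h4]; simpa [SquareAt] using h3⟩
    rw [sq, sq, ← h2']
    exact hpre.eq_of_length_le (by simp; omega)

/-! ### The halving condition -/

/-- The square root condition, for generic intercepts, in the coordinate in which `ψ` is
`u ↦ u / 2`. -/
def HalvingCondition (α : ℝ) (w : Word) : Prop :=
  ∀ u ∈ Ioo (α - 1) α, Generic α u → SquareAt α u w → orbitWord α (u / 2) w.length = w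

/-- Points reading w lie on the same sides of all the relevant separators, so the absence of
crossings at one occurrence passes to every occurrence. -/
lemma NoCrossing.halvingCondition (h0 : 0 < α) (h1 : α < 1) {u : ℝ} {w : Word}
    (hu : u ∈ Ioo (α - 1) α) (hgu : Generic α u) (hs : SquareAt α u w)
    (hN : NoCrossing α u w.length) : HalvingCondition α w := by
  intro v hv hgv hsv
  have h3 := (squareAt_iff.1 hs).1
  have h4 := (squareAt_iff.1 hsv).1
  have hN' := hN.of_orbitWord_eq h0 h1 hu hv hgu (h3.trans h4.symm)
  rw [hN'.orbitWord_half h0 h1 hv hgv, h4]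

/-- Points from which the square of a word can be reached by repeated contraction with ratio `1/2`
towards `c`. -/
lemma exists_contraction {P : ℝ → Prop} {c u : ℝ} (hu : P u)
    (h : ∀ v, P v → P ((v + c) / 2)) (k : ℕ) : P (c + (u - c) / 2 ^ k) := by
  induction k with
  | zero => simpa using hu
  | succ k ih =>
    have := h _ ih
    convert this using 1
    rw [pow_succ]
    field_simp
    ring

lemma exists_div_two_pow_lt (a : ℝ) {ε : ℝ} (hε : 0 < ε) : ∃ k : ℕ, a / 2 ^ k < ε := by
  obtain ⟨k, hk⟩ := pow_unbounded_of_one_lt (a / ε) (one_lt_two (α := ℝ))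
  refine ⟨k, ?_⟩
  rw [div_lt_iff₀ hε] at hk
  rw [div_lt_iff₀ (by positivity)]
  linarith

lemma HalvingCondition.squareAt_half (h0 : 0 < α) (h1 : α < 1) {u δ : ℝ} {w : Word} {p : ℤ}
    (hH : HalvingCondition α w) (hδ : δ = w.length * α - p) (hv : u + δ ∈ Ioo (α - 1) α)
    (hwv : orbitWord α (u + δ) w.length = w) {v : ℝ} (hvI : v ∈ Ioo (α - 1) α)
    (hgv : Generic α v) (hs : SquareAt α v w) (hb : v / 2 + δ ∈ uIcc (v / 2) (u + δ)) :
    SquareAt α (v / 2) w := by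
  have h3 := hH v hvI hgv hs
  refine SquareAt.of_shift p hδ h3 ?_
  rw [orbitWord_eq_of_mem_uIcc h0 h1 (half_mem_Ioo h0 h1 hvI) hv hb (h3.trans hwv.symm), h3]

/-- A contraction step when the square moves towards `0`. -/
lemma HalvingCondition.squareAt_half_sub (h0 : 0 < α) (h1 : α < 1) {δ : ℝ} {w : Word} {p : ℤ}
    (hH : HalvingCondition α w) (hδ : δ = w.length * α - p) {v : ℝ} (hvI : v ∈ Ioo (α - 1) α)
    (hgv : Generic α v) (hs : SquareAt α v w) (hb : v / 2 - δ ∈ uIcc (v / 2) v) :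
    SquareAt α (v / 2 - δ) w := by
  have h3 := hH v hvI hgv hs
  refine SquareAt.of_shift p hδ ?_ (by rw [sub_add_cancel, h3])
  rw [orbitWord_eq_of_mem_uIcc h0 h1 (half_mem_Ioo h0 h1 hvI) hvI hb
    (h3.trans (squareAt_iff.1 hs).1.symm), h3]

/-- Suppose x separates 0 from u. All points reading w stay on the side of u, whereas a suitable
contraction produces occurrences of w² whose halves, or themselves, eventually pass x. The choice of
contraction depends on whether δ points away from 0 or towards 0. -/
lemma HalvingCondition.noCrossing (h0 : 0 < α) (h1 : α < 1) {u : ℝ} {w : Word}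
    (hw : IsPrimitive w) (hH : HalvingCondition α w) (hu : u ∈ Ioo (α - 1) α)
    (hgu : Generic α u) (hs : SquareAt α u w) : NoCrossing α u w.length := by
  obtain ⟨δ, p, hδ, hv, hgv, hwu, hwv⟩ := hs.exists_shift hgu
  have hq := List.length_pos_iff.2 hw.ne_nil
  have hsign := nonneg_iff_of_orbitWord_eq h0 h1 hu hv hq (hwu.trans hwv.symm)
  have hgs : ∀ v, Generic α v → Generic α (v / 2 - δ) := fun v hv =>
    hv.half.of_eq (-w.length) p (by rw [hδ]; push_cast; ring)
  intro i hi hiw j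
  have hsep : ∀ v ∈ Ioo (α - 1) α, orbitWord α v w.length = w →
      ((j - i * α : ℝ) ≤ u ↔ (j - i * α : ℝ) ≤ v) := fun v hv hwv =>
    (orbitWord_eq_iff h0 h1 hu hv _).1 (hwu.trans hwv.symm) i hiw j
  have hnot := hs.not_mem_uIcc h0 h1 hw hu hv hwv hi hiw j
  generalize hx : (j - i * α : ℝ) = x at *
  have hx' : (i * α - j : ℝ) = -x := by rw [← hx]; ring
  rw [hx'] at hnot
  have hsx := hsep _ hv hwv
  constructor
  · intro hx0 hxu
    have hxv := hsx.1 hxu.le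
    rcases le_total 0 δ with hd | hd
    -- When δ points away from 0, v / 2 + δ stays between v / 2 and u + δ, so w² is again read at v
    -- / 2. Plain halving then converges to 0, past x.
    · let P : ℝ → Prop := fun v => v ∈ Ioc 0 u ∧ Generic α v ∧ SquareAt α v w
      have hstep : ∀ v, P v → P ((v + 0) / 2) := by
        rintro v ⟨hv1, hv2, hv3⟩
        rw [add_zero]
        have hvI : v ∈ Ioo (α - 1) α := ⟨by linarith [hv1.1], hv1.2.trans_lt hu.2⟩
        refine ⟨⟨by linarith [hv1.1], by linarith [hv1.1, hv1.2]⟩, hv2.half,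
          hH.squareAt_half h0 h1 hδ hv hwv hvI hv2 hv3
            (mem_uIcc.2 (Or.inl ⟨by linarith, by linarith [hv1.1, hv1.2]⟩))⟩
      obtain ⟨k, hk⟩ := exists_div_two_pow_lt u hx0
      have := exists_contraction (P := P) (c := 0) ⟨⟨by linarith, le_rfl⟩, hgu, hs⟩ hstep k
      rw [zero_add, sub_zero] at this
      obtain ⟨hv1, -, hv3⟩ := this
      have := (hsep _ ⟨by linarith [hv1.1], hv1.2.trans_lt hu.2⟩ (squareAt_iff.1 hv3).1).1 hxu.le
      linarith
    -- When δ points towards 0, v ↦ v / 2 - δ is used: it lands between v / 2 and v and one copy of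
    -- w takes it to v / 2. Primitivity gives -δ < x. The fixed point is -2δ, so v / 2 tends to -δ
    -- and drops below x, although w is read at v / 2.
    · have hxd : -δ < x := by
        by_contra h
        exact hnot (mem_uIcc.2 (Or.inr ⟨by linarith, by linarith⟩))
      let P : ℝ → Prop := fun v => v ∈ Ioc 0 u ∧ Generic α v ∧ SquareAt α v w
      have hlow : ∀ v, P v → x ≤ v / 2 := by
        rintro v ⟨hv1, hv2, hv3⟩
        have hvI : v ∈ Ioo (α - 1) α := ⟨by linarith [hv1.1], hv1.2.trans_lt hu.2⟩
        exact (hsep _ (half_mem_Ioo h0 h1 hvI) (hH v hvI hv2 hv3)).1 hxu.le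
      have hstep : ∀ v, P v → P ((v + -2 * δ) / 2) := by
        intro v hPv
        have hl := hlow v hPv
        obtain ⟨hv1, hv2, hv3⟩ := hPv
        have hvI : v ∈ Ioo (α - 1) α := ⟨by linarith [hv1.1], hv1.2.trans_lt hu.2⟩
        rw [show (v + -2 * δ) / 2 = v / 2 - δ by ring]
        exact ⟨⟨by linarith, by linarith [hv1.2]⟩, hgs v hv2,
          hH.squareAt_half_sub h0 h1 hδ hvI hv2 hv3
            (mem_uIcc.2 (Or.inl ⟨by linarith, by linarith⟩))⟩
      obtain ⟨k, hk⟩ := exists_div_two_pow_lt (u - -2 * δ) (ε := 2 * x + 2 * δ) (by linarith)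
      have := hlow _ (exists_contraction (P := P) (c := -2 * δ)
        ⟨⟨by linarith, le_rfl⟩, hgu, hs⟩ hstep k)
      linarith
  · intro hxu hx0
    have hxv : u + δ < x := by
      by_contra h
      exact absurd (hsx.2 (not_lt.1 h)) (not_le.2 hxu)
    rcases le_total δ 0 with hd | hd
    · let P : ℝ → Prop := fun v => v ∈ Ico u 0 ∧ Generic α v ∧ SquareAt α v w
      have hstep : ∀ v, P v → P ((v + 0) / 2) := by
        rintro v ⟨hv1, hv2, hv3⟩
        rw [add_zero]
        have hvI : v ∈ Ioo (α - 1) α := ⟨hu.1.trans_le hv1.1, by linarith [hv1.2]⟩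
        refine ⟨⟨by linarith [hv1.1, hv1.2], by linarith [hv1.1, hv1.2]⟩, hv2.half,
          hH.squareAt_half h0 h1 hδ hv hwv hvI hv2 hv3
            (mem_uIcc.2 (Or.inr ⟨by linarith [hv1.1, hv1.2], by linarith⟩))⟩
      obtain ⟨k, hk⟩ := exists_div_two_pow_lt (-u) (neg_pos.2 hx0)
      have := exists_contraction (P := P) (c := 0) ⟨⟨le_rfl, by linarith⟩, hgu, hs⟩ hstep k
      rw [zero_add, sub_zero] at this
      obtain ⟨hv1, -, hv3⟩ := this
      have := (hsep _ ⟨hu.1.trans_le hv1.1, by linarith [hv1.2]⟩ (squareAt_iff.1 hv3).1).2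
        (by rw [neg_div] at hk; linarith)
      linarith
    · have hxd : x < -δ := by
        by_contra h
        exact hnot (mem_uIcc.2 (Or.inl ⟨by linarith, by linarith⟩))
      let P : ℝ → Prop := fun v => v ∈ Ico u 0 ∧ Generic α v ∧ SquareAt α v w
      have hlow : ∀ v, P v → v / 2 < x := by
        rintro v ⟨hv1, hv2, hv3⟩
        have hvI : v ∈ Ioo (α - 1) α := ⟨hu.1.trans_le hv1.1, by linarith [hv1.2]⟩
        by_contra h
        have := (hsep _ (half_mem_Ioo h0 h1 hvI) (hH v hvI hv2 hv3)).2 (not_lt.1 h)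
        linarith
      have hstep : ∀ v, P v → P ((v + -2 * δ) / 2) := by
        intro v hPv
        have hl := hlow v hPv
        obtain ⟨hv1, hv2, hv3⟩ := hPv
        have hvI : v ∈ Ioo (α - 1) α := ⟨hu.1.trans_le hv1.1, by linarith [hv1.2]⟩
        rw [show (v + -2 * δ) / 2 = v / 2 - δ by ring]
        exact ⟨⟨by linarith [hv1.1], by linarith⟩, hgs v hv2,
          hH.squareAt_half_sub h0 h1 hδ hvI hv2 hv3
            (mem_uIcc.2 (Or.inr ⟨by linarith, by linarith⟩))⟩
      obtain ⟨k, hk⟩ := exists_div_two_pow_lt (-(u - -2 * δ)) (ε := -(2 * x + 2 * δ))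
        (by linarith)
      have := hlow _ (exists_contraction (P := P) (c := -2 * δ)
        ⟨⟨le_rfl, by linarith⟩, hgu, hs⟩ hstep k)
      rw [neg_div] at hk
      linarith

/-! ### Sturmian words as orbit words -/

lemma rotation_iterate {x : ℝ} (hx : x ∈ Ico (0 : ℝ) 1) (n : ℕ) :
    (rotation α)^[n] x = Int.fract (x + n * α) := by
  induction n with
  | zero => simp [Int.fract_eq_self.2 ⟨hx.1, hx.2⟩]
  | succ n ih =>
    rw [Function.iterate_succ_apply', ih, rotation, Int.fract_eq_fract]
    refine ⟨-⌊x + n * α⌋, ?_⟩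
    rw [Int.fract]
    push_cast
    ring

/-- The side from which a Sturmian word is approximated by generic ones. -/
noncomputable def Convention.side : Convention → ℝ
  | .left => 1
  | .right => -1

lemma arcCode_eq_one {v : ℝ} (j : ℤ) (h0 : 0 ≤ v - j) (hv : v - j < α) (h1 : α < 1) :
    arcCode α v = 1 := by
  have : Int.fract v = v - j := by
    rw [Int.fract_eq_iff]
    exact ⟨h0, by linarith, j, by ring⟩
  rw [arcCode, this, if_pos hv]

lemma arcCode_eq_zero {v : ℝ} (j : ℤ) (h0 : 0 < α) (hv : α ≤ v - j) (h1 : v - j < 1) :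
    arcCode α v = 0 := by
  have : Int.fract v = v - j := by
    rw [Int.fract_eq_iff]
    exact ⟨by linarith, by linarith, j, by ring⟩
  rw [arcCode, this, if_neg (not_lt.2 hv)]

/-- The interval I₁ translated by α is the arc from 0 to α. A small move to the right respects
intervals closed on the left, and a move to the left those closed on the right. -/
lemma exists_arcCode_perturb (h0 : 0 < α) (h1 : α < 1) (c : Convention) {y : ℝ}
    (hy : y ∈ Ico (0 : ℝ) 1) :
    ∃ ε > 0, ∀ h, 0 < h → h < ε → arcCode α (y + α + c.side * h) = coding c α y := by
  cases c with
  | left =>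
    simp only [coding, I₀, Convention.side, one_mul]
    by_cases h2 : y ∈ Ico 0 (1 - α)
    · simp only [h2, ↓reduceIte]
      refine ⟨1 - α - y, by linarith [h2.2], fun h hh hh2 => arcCode_eq_zero 0 h0 ?_ ?_⟩ <;>
        push_cast <;> linarith [h2.1]
    · simp only [h2, ↓reduceIte]
      have h3 : 1 - α ≤ y := by
        by_contra h3
        exact h2 ⟨hy.1, not_le.1 h3⟩
      refine ⟨1 - y, by linarith [hy.2], fun h hh hh2 => arcCode_eq_one 1 ?_ ?_ h1⟩ <;>
        push_cast <;> linarith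
  | right =>
    simp only [coding, I₀, Convention.side, neg_mul, one_mul]
    by_cases h2 : y ∈ Ioc 0 (1 - α)
    · simp only [h2, ↓reduceIte]
      refine ⟨y, h2.1, fun h hh hh2 => arcCode_eq_zero 0 h0 ?_ ?_⟩ <;>
        push_cast <;> linarith [h2.2]
    · simp only [h2, ↓reduceIte]
      rcases eq_or_lt_of_le hy.1 with h3 | h3
      · refine ⟨α, h0, fun h hh hh2 => arcCode_eq_one 0 ?_ ?_ h1⟩ <;> push_cast <;> linarith
      · have h4 : 1 - α < y := by
          by_contra h4
          exact h2 ⟨h3, not_lt.1 h4⟩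
        refine ⟨y - (1 - α), by linarith, fun h hh hh2 => arcCode_eq_one 1 ?_ ?_ h1⟩ <;>
          push_cast <;> linarith [hy.2]

lemma exists_sturmianWord_perturb (h0 : 0 < α) (h1 : α < 1) (c : Convention) {x : ℝ}
    (hx : x ∈ Ico (0 : ℝ) 1) (N : ℕ) :
    ∃ ε > 0, ∀ h, 0 < h → h < ε → ∀ i < N,
      arcCode α (x + α + c.side * h + i * α) = sturmianWord c α x i := by
  induction N with
  | zero => exact ⟨1, one_pos, fun _ _ _ i hi => absurd hi (Nat.not_lt_zero i)⟩
  | succ N ih =>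
    obtain ⟨ε, hε, h2⟩ := ih
    obtain ⟨ε', hε', h3⟩ := exists_arcCode_perturb h0 h1 c
      (y := Int.fract (x + N * α)) ⟨Int.fract_nonneg _, Int.fract_lt_one _⟩
    refine ⟨min ε ε', lt_min hε hε', fun h hh hh2 i hi => ?_⟩
    rcases Nat.lt_succ_iff_lt_or_eq.1 hi with hi | rfl
    · exact h2 h hh (hh2.trans_le (min_le_left _ _)) i hi
    · rw [sturmianWord, rotation_iterate hx, ← h3 h hh (hh2.trans_le (min_le_right _ _)),
        ← arcCode_add_int (Int.fract (x + i * α) + α + c.side * h) ⌊x + i * α⌋]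
      congr 1
      rw [Int.fract]
      ring

lemma Generic.sturmianWord_eq (h0 : 0 < α) (h1 : α < 1) (c : Convention) {u : ℝ}
    (hu : u ∈ Ioo (α - 1) α) (hgu : Generic α u) (n : ℕ) :
    sturmianWord c α (u + 1 - α) n = arcCode α (u + n * α) := by
  have hx : u + 1 - α ∈ Ico (0 : ℝ) 1 := by constructor <;> linarith [hu.1, hu.2]
  rw [sturmianWord, rotation_iterate hx]
  set v := u + 1 - α + n * α with hv
  have hfl := Int.floor_add_fract v
  have hf0 := Int.fract_nonneg v
  have hf1 := Int.fract_lt_one v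
  have h3 : Int.fract v ≠ 0 := by
    intro h
    exact hgu (1 - n) (⌊v⌋ - 1) (by push_cast; linarith)
  have h4 : Int.fract v ≠ 1 - α := by
    intro h
    exact hgu (- n) ⌊v⌋ (by push_cast; linarith)
  have hpos : 0 < Int.fract v := lt_of_le_of_ne hf0 (Ne.symm h3)
  have hmem : Int.fract v ∈ I₀ c α ↔ Int.fract v < 1 - α := by
    cases c with
    | left => exact ⟨fun h => h.2, fun h => ⟨hf0, h⟩⟩
    | right => exact ⟨fun h => lt_of_le_of_ne h.2 h4, fun h => ⟨hpos, h.le⟩⟩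
  rw [coding]
  split_ifs with h5
  · rw [hmem] at h5
    refine (arcCode_eq_zero (⌊v⌋ - 1) h0 ?_ ?_).symm <;> push_cast <;> linarith
  · rw [hmem, not_lt] at h5
    refine (arcCode_eq_one ⌊v⌋ ?_ ?_ h1).symm <;> linarith

lemma occursAt_iff {u : ℝ} {s : ℕ → Fin 2} {m : ℕ} {w : Word}
    (h : ∀ i < w.length, arcCode α (u + i * α) = s (m + i)) :
    OccursAt w s m ↔ orbitWord α u w.length = w := by
  constructor
  · intro h2
    refine List.ext_getElem (by simp) fun i h3 h4 => ?_
    rw [getElem_orbitWord, h i h4, h2 i h4]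
  · intro h2 i hi
    rw [← h i hi, ← getElem_orbitWord u w.length i (by simpa using hi)]
    simp only [h2]

lemma mem_language_iff (h0 : 0 < α) (h1 : α < 1) {w : Word} :
    w ∈ language α ↔ ∃ u ∈ Ioo (α - 1) α, Generic α u ∧ orbitWord α u w.length = w := by
  constructor
  · rintro ⟨c, x, hx, m, hm⟩
    obtain ⟨ε, hε, h2⟩ := exists_sturmianWord_perturb h0 h1 c hx (m + w.length)
    obtain ⟨h, ⟨hh, hh2⟩, hg⟩ : ∃ h ∈ Ioo 0 ε, Generic α (x + α + c.side * h) := by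
      cases c with
      | left =>
        obtain ⟨v, hv, hg⟩ := exists_generic α (show x + α < x + α + ε by linarith)
        refine ⟨v - (x + α), ⟨by linarith [hv.1], by linarith [hv.2]⟩, ?_⟩
        simpa [Convention.side] using hg
      | right =>
        obtain ⟨v, hv, hg⟩ := exists_generic α (show x + α - ε < x + α by linarith)
        refine ⟨(x + α) - v, ⟨by linarith [hv.2], by linarith [hv.1]⟩, ?_⟩
        simpa [Convention.side] using hg
    have h3 := h2 h hh hh2
    obtain ⟨j, hj, hgj⟩ := hg.shift m
    refine ⟨_, hj, hgj, ?_⟩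
    rw [← occursAt_iff (s := sturmianWord c α x) (m := m)]
    · exact hm
    · intro i hi
      rw [← h3 (m + i) (by omega), ← arcCode_add_int _ j]
      congr 1
      push_cast
      ring
  · rintro ⟨u, hu, hgu, h⟩
    refine ⟨.left, u + 1 - α, ⟨by linarith [hu.1], by linarith [hu.2]⟩, 0, ?_⟩
    rw [occursAt_iff (α := α) (u := u)]
    · exact h
    · intro i _
      rw [hgu.sturmianWord_eq h0 h1 _ hu, zero_add]

lemma sq_mem_language_iff (h0 : 0 < α) (h1 : α < 1) {w : Word} :
    sq w ∈ language α ↔ ∃ u ∈ Ioo (α - 1) α, Generic α u ∧ SquareAt α u w := by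
  rw [mem_language_iff h0 h1, length_sq]
  rfl

/-- The coordinate of an intercept, in which `ψ` is `u ↦ u / 2`. -/
lemma exists_coordinate (h0 : 0 < α) (h1 : α < 1) (c : Convention) {x : ℝ}
    (hx : x ∈ Ico (0 : ℝ) 1) : ∃ (y : ℝ) (j : ℤ), x + α = y + j ∧ psi c α x = y / 2 + 1 - α ∧
      ∃ ε > 0, ∀ h, 0 < h → h < ε → y + c.side * h ∈ Ioo (α - 1) α := by
  cases c with
  | left =>
    refine ⟨x + α - 1, 1, by push_cast; ring, ?_, 1 - x, by linarith [hx.2], ?_⟩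
    · rw [psi]
      split_ifs with h
      · simp only [h]; ring
      · ring
    · intro h hh hh2
      simp only [Convention.side]
      constructor <;> linarith [hx.1]
  | right =>
    -- Under the right convention the intercept 0 stands for 1, so its coordinate is the upper end
    -- α; this accounts for the exceptional value of ψ at 0.
    rcases eq_or_lt_of_le hx.1 with rfl | h
    · refine ⟨α, 0, by simp, ?_, 1, one_pos, ?_⟩
      · rw [psi, if_pos rfl]
        ring
      · intro h hh hh2
        simp only [Convention.side]
        constructor <;> linarith
    · refine ⟨x + α - 1, 1, by push_cast; ring, ?_, x, h, ?_⟩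
      · rw [psi, if_neg h.ne']
        ring
      · intro h hh hh2
        simp only [Convention.side]
        constructor <;> linarith [hx.2]

lemma psi_mem_Ico (h0 : 0 < α) (h1 : α < 1) (c : Convention) {x : ℝ} (hx : x ∈ Ico (0 : ℝ) 1) :
    psi c α x ∈ Ico (0 : ℝ) 1 := by
  unfold psi
  split_ifs with h
  · cases c <;> constructor <;> simp only <;> linarith
  · constructor <;> linarith [hx.1, hx.2]

/-- The square root condition can be tested on generic intercepts. -/
lemma squareRootCondition_iff (h0 : 0 < α) (h1 : α < 1) (c : Convention) (w : Word) :
    SquareRootCondition c α w ↔ sq w ∈ language α ∧ HalvingCondition α w := by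
  refine and_congr_right fun _ => ⟨fun h u hu hgu hs => ?_, fun hH => ?_⟩
  · have hu2 := half_mem_Ioo h0 h1 hu
    have hx : u + 1 - α ∈ Ico (0 : ℝ) 1 := by constructor <;> linarith [hu.1, hu.2]
    have hmem : u + 1 - α ∈ interval c α (sq w) := by
      refine ⟨hx, ?_⟩
      rw [occursAt_iff (α := α) (u := u)]
      · rw [length_sq]; exact hs
      · intro i _
        rw [hgu.sturmianWord_eq h0 h1 _ hu, zero_add]
    have h2 := (h (mem_image_of_mem _ hmem)).2
    have hpsi : psi c α (u + 1 - α) = u / 2 + 1 - α := by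
      unfold psi
      rw [if_neg (by linarith [hu.1])]
      ring
    rw [hpsi, occursAt_iff (α := α) (u := u / 2)] at h2
    · exact h2
    · intro i _
      rw [hgu.half.sturmianWord_eq h0 h1 _ hu2, zero_add]
  · rintro _ ⟨x, ⟨hx, hocc⟩, rfl⟩
    have hpx := psi_mem_Ico h0 h1 c hx
    refine ⟨hpx, ?_⟩
    obtain ⟨y, j, hxy, hpsi, ε₁, hε₁, hI⟩ := exists_coordinate h0 h1 c hx
    obtain ⟨ε₂, hε₂, h2⟩ := exists_sturmianWord_perturb h0 h1 c hx (sq w).length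
    obtain ⟨ε₃, hε₃, h3⟩ := exists_sturmianWord_perturb h0 h1 c hpx w.length
    obtain ⟨h, hh, hg⟩ : ∃ h ∈ Ioo 0 (min ε₁ (min ε₂ ε₃)), Generic α (y + c.side * h) := by
      have hmin : 0 < min ε₁ (min ε₂ ε₃) := lt_min hε₁ (lt_min hε₂ hε₃)
      cases c with
      | left =>
        obtain ⟨v, hv, hg⟩ := exists_generic α (show y < y + min ε₁ (min ε₂ ε₃) by linarith)
        refine ⟨v - y, ⟨by linarith [hv.1], by linarith [hv.2]⟩, ?_⟩
        simpa [Convention.side] using hg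
      | right =>
        obtain ⟨v, hv, hg⟩ := exists_generic α (show y - min ε₁ (min ε₂ ε₃) < y by linarith)
        refine ⟨y - v, ⟨by linarith [hv.2], by linarith [hv.1]⟩, ?_⟩
        simpa [Convention.side] using hg
    have hh1 := hh.2.trans_le (min_le_left _ _)
    have hh2 := hh.2.trans_le ((min_le_right _ _).trans (min_le_left _ _))
    have hh3 := hh.2.trans_le ((min_le_right _ _).trans (min_le_right _ _))
    have hs : SquareAt α (y + c.side * h) w := by
      rw [occursAt_iff (α := α) (u := y + c.side * h), length_sq] at hocc
      · exact hocc
      · intro i hi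
        rw [zero_add, ← h2 h hh.1 hh2 i hi, ← arcCode_add_int _ j]
        congr 1
        linarith
    have h4 := hH _ (hI h hh.1 hh1) hg hs
    rw [occursAt_iff (α := α) (u := (y + c.side * h) / 2)]
    · exact h4
    · intro i hi
      -- Halving turns the displacement h of x into the displacement h / 2 of ψ(x), on the same
      -- side.
      rw [zero_add, ← h3 (h / 2) (by linarith [hh.1]) (by linarith [hh.1]) i hi,
        ← arcCode_add_int _ 1, hpsi]
      congr 1
      push_cast
      ring

/-! ### Solutions of the word equation -/

/-- Each minimal square has no crossing, so its root is read at u / 2. After the square, u has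
become u + 2δ, still in the fundamental domain, and u / 2 has become u / 2 + δ, exactly its half;
the induction proceeds from there. -/
lemma orbitWord_half_flatten (hα : Irrational α) (h0 : 0 < α) (h2 : α < 1 / 2) (X : List Word)
    (hX : ∀ x ∈ X, IsMinimalSquareRoot x) (u : ℝ) (hu : u ∈ Ioo (α - 1) α) (hgu : Generic α u)
    (h : orbitWord α u (X.map sq).flatten.length = (X.map sq).flatten) :
    orbitWord α (u / 2) X.flatten.length = X.flatten := by
  have h1 : α < 1 := by linarith
  induction X generalizing u with
  | nil => simp
  | cons x X ih =>
    have hx := hX x (by simp)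
    simp only [List.map_cons, List.flatten_cons, List.length_append] at h ⊢
    rw [orbitWord_add_eq_append_iff u rfl] at h
    obtain ⟨hs, hrest⟩ := h
    rw [length_sq] at hs hrest
    have hs' : SquareAt α u x := hs
    have hN := hx.noCrossing hα h0 h1 hu hgu hs'
    obtain ⟨δ, p, hδ, hv, hgv, hwu, hwv⟩ := hs'.exists_shift hgu
    have hy := add_two_mul_shift_mem h0 h2 hx.isPrimitive hu hgu hs' hN hδ hv hgv hwv
    have hgy : Generic α (u + 2 * δ) := hgu.of_eq (2 * x.length) (-(2 * p))
      (by rw [hδ]; push_cast; ring)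
    rw [orbitWord_add_eq_append_iff _ rfl, hN.orbitWord_half h0 h1 hu hgu]
    refine ⟨hwu, ?_⟩
    rw [orbitWord_eq_of_add_int p (u := (u + 2 * δ) / 2) (by rw [hδ]; ring)]
    apply ih (fun y hy => hX y (by simp [hy])) _ hy hgy
    rw [orbitWord_eq_of_add_int (2 * p) (u := u + 2 * δ) (by rw [hδ]; push_cast; ring)] at hrest
    exact hrest

lemma IsSolutionIn.halvingCondition (hα : Irrational α) (h0 : 0 < α) (h2 : α < 1 / 2) {w : Word}
    (h : IsSolutionIn α w) : HalvingCondition α w := by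
  obtain ⟨-, -, X, hX, rfl, hsq⟩ := h
  intro u hu hgu hs
  apply orbitWord_half_flatten hα h0 h2 X (fun x hx => (hX x hx).1) u hu hgu
  rw [hsq, length_sq]
  exact hs

/-- After a piece of length `P` of a primitive square with no crossing, there is another square of
root length at most `w.length - P`. -/
lemma exists_return_between (h0 : 0 < α) (h1 : α < 1) {u δ : ℝ} {w : Word} {p : ℤ}
    (hw : IsPrimitive w) (hu : u ∈ Ioo (α - 1) α) (hgu : Generic α u) (hs : SquareAt α u w)
    (hN : NoCrossing α u w.length) (hδ : δ = w.length * α - p) (hv : u + δ ∈ Ioo (α - 1) α)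
    (hgv : Generic α (u + δ)) (hwv : orbitWord α (u + δ) w.length = w) {P : ℕ} (hP : 1 ≤ P)
    (hPw : P < w.length) {y : ℝ} (b : ℤ) (hy : y = u + 2 * (P * α - b)) :
    (0 < ((p - b : ℤ) - (w.length - P : ℕ) * α : ℝ) ∧
      ((p - b : ℤ) - (w.length - P : ℕ) * α : ℝ) < y) ∨
    (y < ((p - b : ℤ) - (w.length - P : ℕ) * α : ℝ) ∧
      ((p - b : ℤ) - (w.length - P : ℕ) * α : ℝ) < 0) := by
  have hwu := (squareAt_iff.1 hs).1
  have hN' : NoCrossing α (u + δ) w.length :=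
    hN.of_orbitWord_eq h0 h1 hu hv hgu (hwu.trans hwv.symm)
  have hsign := nonneg_iff_of_orbitWord_eq h0 h1 hu hv (by omega) (hwu.trans hwv.symm)
  have hne1 := hgu.ne_sub P b
  have hne2 := hgv.ne_sub P b
  have hc1 := hs.not_mem_uIcc h0 h1 hw hu hv hwv hP hPw b
  have hc2 := hN P hP hPw b
  have hc3 := hN' P hP hPw b
  have hu0 := hgu.ne_zero
  have hv0 := hgv.ne_zero
  -- With κ = Pα - b the candidate is κ - δ and y = u + 2κ, so the claim is that κ - δ and u + δ + κ
  -- have the same sign. Primitivity keeps κ away from the segment from 0 to δ, and -κ does not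
  -- cross between 0 and u or u + δ.
  have hx : ((p - b : ℤ) - (w.length - P : ℕ) * α : ℝ) = (P * α - b) - δ := by
    rw [Nat.cast_sub hPw.le, hδ]
    push_cast
    ring
  have hκ : (b - P * α : ℝ) = -(P * α - b) := by ring
  rw [hx, hy]
  rw [hκ] at hne1 hne2 hc2 hc3
  generalize (P * α - b : ℝ) = κ at *
  rw [mem_uIcc, not_or, not_and_or, not_and_or] at hc1
  obtain ⟨hc11, hc12⟩ := hc1
  rcases lt_or_gt_of_ne hu0 with hneg | hpos
  · have hneg' : u + δ < 0 := by
      by_contra h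
      exact absurd (hsign.2 (not_lt.1 h)) (not_le.2 hneg)
    rcases le_total 0 δ with hd | hd
    · rcases lt_trichotomy κ 0 with hk | hk | hk
      · right; constructor <;> linarith
      · exfalso; rcases hc11 with h | h <;> exact h (by linarith)
      · have h3 : -κ < u := lt_of_le_of_ne
          (by by_contra h; exact hc2.2 (not_le.1 h) (by linarith)) hne1
        left; constructor <;> linarith
    · rcases le_total κ 0 with hk | hk
      · have h3 : κ < δ := by
          by_contra h
          rcases hc12 with h' | h' <;> exact h' (by linarith)
        right; constructor <;> linarith
      · have hk' : 0 < κ := lt_of_le_of_ne hk (by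
          rintro rfl; rcases hc12 with h | h <;> exact h (by linarith))
        have h3 : -κ < u + δ := lt_of_le_of_ne
          (by by_contra h; exact hc3.2 (not_le.1 h) (by linarith)) hne2
        left; constructor <;> linarith
  · have hpos' : 0 < u + δ := lt_of_le_of_ne (hsign.1 hpos.le) (Ne.symm hv0)
    rcases le_total 0 δ with hd | hd
    · rcases le_total 0 κ with hk | hk
      · have h3 : δ < κ := by
          by_contra h
          rcases hc11 with h' | h' <;> exact h' (by linarith)
        left; constructor <;> linarith
      · have hk' : κ < 0 := lt_of_le_of_ne hk (by
          rintro rfl; rcases hc11 with h | h <;> exact h (by linarith))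
        have h3 : u + δ < -κ := lt_of_le_of_ne
          (by by_contra h; exact hc3.1 (by linarith) (not_le.1 h)) hne2.symm
        right; constructor <;> linarith
    · rcases lt_trichotomy κ 0 with hk | hk | hk
      · have h3 : u < -κ := lt_of_le_of_ne
          (by by_contra h; exact hc2.1 (by linarith) (not_le.1 h)) hne1.symm
        right; constructor <;> linarith
      · exfalso; rcases hc12 with h | h <;> exact h (by linarith)
      · left; constructor <;> linarith

/-- The invariant is that P letters of w have been factored and y is the point reached after the
corresponding 2P letters of w²; k letters of w remain. The shortest square at y has root length at
most k, so the greedy factorization never overshoots and ends exactly at |w|. -/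
lemma exists_minimal_factorization (hα : Irrational α) (h0 : 0 < α) (h2 : α < 1 / 2) {u : ℝ}
    {w : Word} (hw : IsPrimitive w) (hu : u ∈ Ioo (α - 1) α) (hgu : Generic α u)
    (hs : SquareAt α u w) (hN : NoCrossing α u w.length) (k : ℕ) (P : ℕ) (hPk : P + k = w.length)
    (y : ℝ) (hy : y ∈ Ioo (α - 1) α) (b : ℤ) (hyb : y = u + 2 * (P * α - b)) :
    ∃ X : List Word, (∀ x ∈ X, IsMinimalSquareRoot x ∧ sq x ∈ language α) ∧
      (X.map sq).flatten = orbitWord α y (k + k) ∧ X.flatten = orbitWord α (y / 2) k := by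
  have h1 : α < 1 := by linarith
  induction k using Nat.strong_induction_on generalizing P y b with
  | _ k ih =>
    rcases Nat.eq_zero_or_pos k with rfl | hk
    · exact ⟨[], by simp, by simp, by simp⟩
    have hgy : Generic α y := hgu.of_eq (2 * P) (-(2 * b)) (by rw [hyb]; push_cast; ring)
    obtain ⟨δ, p, hδ, hv, hgv, hwu, hwv⟩ := hs.exists_shift hgu
    obtain ⟨m, hm, hmk, hsm⟩ : ∃ m, 1 ≤ m ∧ m ≤ k ∧ SquareAt α y (orbitWord α y m) := by
      rcases Nat.eq_zero_or_pos P with rfl | hP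
      · have hb0 : b = 0 := by
          have h3 : (b : ℝ) < 1 := by push_cast at hyb; linarith [hu.2, hy.1]
          have h4 : (-1 : ℝ) < b := by push_cast at hyb; linarith [hu.1, hy.2]
          have h3' : b < 1 := by exact_mod_cast h3
          have h4' : -1 < b := by exact_mod_cast h4
          omega
        have hyu : y = u := by rw [hyb, hb0]; simp
        obtain rfl : k = w.length := by omega
        exact ⟨w.length, hk, le_rfl, by rw [hyu, hwu]; exact hs⟩
      · obtain ⟨m, hm, hmk, hsm, -⟩ := exists_squareAt_noCrossing_le h0 h1 hy hgy (m := w.length - P)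
          (by omega) (exists_return_between h0 h1 hw hu hgu hs hN hδ hv hgv hwv hP (by omega) b hyb)
        exact ⟨m, hm, by omega, hsm⟩
    obtain ⟨n, hn, hnm, hmin, hsn⟩ := exists_isMinimalSquareRoot_le hm hsm
    have hNn := hmin.noCrossing hα h0 h1 hy hgy hsn
    obtain ⟨η, r, hη, hz, hgz, hwy, hwz⟩ := hsn.exists_shift hgy
    have hz2 := add_two_mul_shift_mem h0 h2 hmin.isPrimitive hy hgy hsn hNn hη hz hgz hwz
    rw [length_orbitWord] at hη hNn
    obtain ⟨X, hX, hX1, hX2⟩ := ih (k - n) (by omega) (P + n) (by omega) (y + 2 * η) hz2 (b + r)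
      (by rw [hyb, hη]; push_cast; ring)
    refine ⟨orbitWord α y n :: X, ?_, ?_, ?_⟩
    · intro x hx
      rcases List.mem_cons.1 hx with rfl | hx
      · exact ⟨hmin, (sq_mem_language_iff h0 h1).2 ⟨y, hy, hgy, hsn⟩⟩
      · exact hX x hx
    · have e : k + k = (n + n) + ((k - n) + (k - n)) := by omega
      have h3 : orbitWord α y (n + n) = orbitWord α y n ++ orbitWord α y n := by
        simpa [SquareAt] using hsn
      rw [List.map_cons, List.flatten_cons, hX1, e, orbitWord_add _ (n + n), h3, sq,
        orbitWord_eq_of_add_int (2 * r) (u := y + 2 * η) (v := y + (n + n : ℕ) * α)]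
      rw [hη]; push_cast; ring
    · obtain ⟨l, rfl⟩ := Nat.exists_eq_add_of_le (hnm.trans hmk)
      rw [Nat.add_sub_cancel_left] at hX2
      rw [List.flatten_cons, hX2, orbitWord_add, hNn.orbitWord_half h0 h1 hy hgy,
        orbitWord_eq_of_add_int r (u := (y + 2 * η) / 2) (v := y / 2 + n * α)]
      rw [hη]; ring

lemma NoCrossing.isSolutionIn (hα : Irrational α) (h0 : 0 < α) (h2 : α < 1 / 2) {u : ℝ}
    {w : Word} (hw : IsPrimitive w) (hu : u ∈ Ioo (α - 1) α) (hgu : Generic α u)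
    (hs : SquareAt α u w) (hN : NoCrossing α u w.length) : IsSolutionIn α w := by
  have h1 : α < 1 := by linarith
  obtain ⟨X, hX, hX1, hX2⟩ := exists_minimal_factorization hα h0 h2 hw hu hgu hs hN w.length 0
    (by omega) u hu 0 (by simp)
  rw [hN.orbitWord_half h0 h1 hu hgu, (squareAt_iff.1 hs).1] at hX2
  refine ⟨hw.ne_nil, (sq_mem_language_iff h0 h1).2 ⟨u, hu, hgu, hs⟩, X, hX, hX2.symm, ?_⟩
  rw [hX1, hX2]
  exact hs

/-! ### Reversed standard words as orbit words -/

lemma reverse_semistandardWord (k l : ℕ) : (semistandardWord α k l).reverse =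
    (standardWord α k).reverse ++ wordPow (standardWord α (k + 1)).reverse l := by
  rw [semistandardWord, List.reverse_append, reverse_wordPow]

lemma reverse_semistandardWord_succ (k l : ℕ) : (semistandardWord α k (l + 1)).reverse =
    (semistandardWord α k l).reverse ++ (standardWord α (k + 1)).reverse := by
  rw [reverse_semistandardWord, reverse_semistandardWord, wordPow_succ', List.append_assoc]

lemma semistandard_mul_sub (ha : 1 ≤ partialQuotient α 1) (k l : ℕ) :
    ((l * convLength α (k + 1) + convLength α k : ℕ) : ℝ) * α -
      ((l * convHeight α (k + 1) + convHeight α k : ℕ) : ℝ) =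
    (-1) ^ k * (remainder α (k + 1) - l * remainder α (k + 2)) := by
  have h1 := convLength_mul_sub ha k
  have h2 := convLength_mul_sub ha (k + 1)
  push_cast
  linear_combination h1 + l * h2

lemma remainder_le_self (hα : Irrational α) (h0 : 0 < α) (h1 : α < 1) (k : ℕ) :
    remainder α (k + 1) ≤ α := by
  induction k with
  | zero => simp
  | succ k ih => exact (remainder_succ_lt hα h0 h1 (k + 1)).le.trans ih

lemma orbitWord_eq_wordPow_zero {u : ℝ} {n : ℕ}
    (h : ∀ i < n, arcCode α (u + i * α) = 0) : orbitWord α u n = wordPow [0] n := by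
  induction n with
  | zero => rfl
  | succ n ih =>
    rw [orbitWord_add, wordPow_succ', ih fun i hi => h i (by omega)]
    congr 1
    simp [orbitWord, h n (by omega)]

/-- Reversed, s_{k+1} is appended at the right. After the reversal of s_{k+1}^l s_k the point at
distance t from 0 has jumped across 0 to distance r_{k+1} - l r_{k+2} - t, on the side where the
reversal of s_{k+1} is read. -/
lemma orbitWord_reverse_semistandardWord_succ (hα : Irrational α) (h0 : 0 < α) (h2 : α < 1 / 2)
    (k : ℕ)
    (hk : ∀ t, 0 < t → t < remainder α k → t < 1 - α →
      orbitWord α (-(-1) ^ k * t) (convLength α k) = (standardWord α k).reverse)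
    (hk' : ∀ t, 0 < t → t < remainder α (k + 1) → t < 1 - α →
      orbitWord α (-(-1) ^ (k + 1) * t) (convLength α (k + 1)) =
        (standardWord α (k + 1)).reverse)
    (l : ℕ) (t : ℝ) (ht : 0 < t) (htl : t < remainder α (k + 1) - l * remainder α (k + 2)) :
    orbitWord α (-(-1) ^ k * t) ((l + 1) * convLength α (k + 1) + convLength α k) =
      (semistandardWord α k (l + 1)).reverse := by
  have h1 : α < 1 := by linarith
  have ha : 1 ≤ partialQuotient α 1 := one_le_partialQuotient hα h0 h1 0
  have hpos := remainder_pos hα h0 h1 (k + 2)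
  have hle := remainder_le_self hα h0 h1 k
  have hl0 : 0 ≤ (l : ℝ) * remainder α (k + 2) := by positivity
  have e : (l + 1) * convLength α (k + 1) + convLength α k =
      (l * convLength α (k + 1) + convLength α k) + convLength α (k + 1) := by ring
  have hfirst : orbitWord α (-(-1) ^ k * t) (l * convLength α (k + 1) + convLength α k) =
      (semistandardWord α k l).reverse := by
    induction l with
    | zero =>
      rw [semistandardWord_zero, zero_mul, zero_add]
      exact hk t ht (by linarith [remainder_succ_lt hα h0 h1 k]) (by linarith)
    | succ l ih =>
      have e : (l + 1) * convLength α (k + 1) + convLength α k =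
        (l * convLength α (k + 1) + convLength α k) + convLength α (k + 1) := by ring
      have hl0' : 0 ≤ (l : ℝ) * remainder α (k + 2) := by positivity
      push_cast at htl
      have htl' : t < remainder α (k + 1) - l * remainder α (k + 2) := by linarith
      have := ih htl' hl0' e
      rw [e, orbitWord_add, this, reverse_semistandardWord_succ]
      congr 1
      rw [orbitWord_eq_of_add_int ((l * convHeight α (k + 1) + convHeight α k : ℕ) : ℤ)
        (u := -(-1) ^ (k + 1) * (remainder α (k + 1) - l * remainder α (k + 2) - t))]
      · exact hk' _ (by linarith) (by linarith) (by linarith)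
      · have := semistandard_mul_sub ha k l
        rw [Int.cast_natCast]
        linear_combination this
  rw [e, orbitWord_add, hfirst, reverse_semistandardWord_succ]
  congr 1
  rw [orbitWord_eq_of_add_int ((l * convHeight α (k + 1) + convHeight α k : ℕ) : ℤ)
    (u := -(-1) ^ (k + 1) * (remainder α (k + 1) - l * remainder α (k + 2) - t))]
  · exact hk' _ (by linarith) (by linarith) (by linarith)
  · have := semistandard_mul_sub ha k l
    rw [Int.cast_natCast]
    linear_combination this

/-- The reversal of the `k`-th standard word is the prefix of the orbit words of all points close
to `0` on one side. -/
lemma orbitWord_reverse_standardWord (hα : Irrational α) (h0 : 0 < α) (h2 : α < 1 / 2) (k : ℕ) :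
    ∀ t, 0 < t → t < remainder α k → t < 1 - α →
      orbitWord α (-(-1) ^ k * t) (convLength α k) = (standardWord α k).reverse := by
  have h1 : α < 1 := by linarith
  have ha : 1 ≤ partialQuotient α 1 := one_le_partialQuotient hα h0 h1 0
  induction k using Nat.twoStepInduction with
  | zero =>
    intro t ht _ ht2
    have : arcCode α (-t) = 0 := by
      refine arcCode_eq_zero (-1) h0 ?_ ?_ <;> push_cast <;> linarith
    simp [convLength_zero, orbitWord, standardWord, this]
  | one =>
    intro t ht ht1 _
    rw [remainder_one] at ht1
    have h3 := remainder_add_two (α := α) 0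
    have h4 := remainder_pos hα h0 h1 2
    simp only [remainder_zero, zero_add, remainder_one] at h3
    rw [h3] at h4
    have hc : ((partialQuotient α 1 - 1 : ℕ) : ℝ) = partialQuotient α 1 - 1 := by
      rw [Nat.cast_sub ha]; simp
    have e : convLength α 1 = 1 + (partialQuotient α 1 - 1) := by
      rw [convLength_one ha]; omega
    have ht' : arcCode α t = 1 := arcCode_eq_one 0 (by simpa using ht.le) (by simpa using ht1) h1
    rw [e, orbitWord_add, orbitWord_eq_wordPow_zero (u := -(-1) ^ 1 * t + (1 : ℕ) * α)]
    · simp [orbitWord, standardWord, reverse_wordPow, ht']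
    · intro i hi
      have h5 : (i : ℝ) + 1 ≤ partialQuotient α 1 - 1 := by
        rw [← hc]
        exact_mod_cast hi
      have h6 : (i : ℝ) * α + α ≤ (partialQuotient α 1 - 1) * α := by nlinarith
      have h7 : 0 ≤ (i : ℝ) * α := by positivity
      refine arcCode_eq_zero 0 h0 ?_ ?_ <;> push_cast <;> linarith
  | more k hk hk' =>
    intro t ht ht1 _
    -- With a + 1 as partial quotient the admissible bound is r_{k+1} - a r_{k+2} = r_{k+2} +
    -- r_{k+3}, which exceeds t.
    obtain ⟨a, haa⟩ : ∃ a, partialQuotient α (k + 2) = a + 1 :=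
      ⟨partialQuotient α (k + 2) - 1, by
        have : 1 ≤ partialQuotient α (k + 2) := one_le_partialQuotient hα h0 h1 (k + 1)
        omega⟩
    have h3 := remainder_add_two (α := α) (k + 1)
    have h4 := remainder_pos hα h0 h1 (k + 3)
    rw [show k + 1 + 2 = k + 3 from rfl, show k + 1 + 1 = k + 2 from rfl, haa] at h3
    push_cast at h3
    have := orbitWord_reverse_semistandardWord_succ hα h0 h2 k hk hk' a t ht (by linarith)
    rw [convLength_add_two, standardWord_add_two, haa, ← this]
    congr 1
    rw [pow_add]
    norm_num

lemma orbitWord_reverse_semistandardWord (hα : Irrational α) (h0 : 0 < α) (h2 : α < 1 / 2)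
    (k l : ℕ) (t : ℝ) (ht : 0 < t)
    (htl : t < remainder α (k + 1) - l * remainder α (k + 2)) :
    orbitWord α (-(-1) ^ k * t) ((l + 1) * convLength α (k + 1) + convLength α k) =
      (semistandardWord α k (l + 1)).reverse :=
  orbitWord_reverse_semistandardWord_succ hα h0 h2 k
    (orbitWord_reverse_standardWord hα h0 h2 k) (orbitWord_reverse_standardWord hα h0 h2 (k + 1))
    l t ht htl

/-! ### Best approximations -/

/-- The convergents are best approximations. -/
lemma remainder_le_abs (hα : Irrational α) (h0 : 0 < α) (h1 : α < 1) (k : ℕ) {i : ℕ}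
    (hi : 1 ≤ i) (hik : i < convLength α (k + 1)) (j : ℤ) :
    remainder α (k + 1) ≤ |i * α - j| := by
  have ha : 1 ≤ partialQuotient α 1 := one_le_partialQuotient hα h0 h1 0
  have hdet := convLength_det (α := α) k
  have d1 := convLength_mul_sub ha k
  have d2 := convLength_mul_sub ha (k + 1)
  have hq1 := convLength_pos (α := α) k
  have e1 := remainder_pos hα h0 h1 (k + 1)
  have e2 := remainder_pos hα h0 h1 (k + 2)
  generalize convLength α (k + 1) = Q1 at *
  generalize convLength α k = Q0 at *
  generalize convHeight α (k + 1) = P1 at *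
  generalize convHeight α k = P0 at *
  rw [show k + 1 + 1 = k + 2 from rfl] at d2
  generalize remainder α (k + 1) = r0 at *
  generalize remainder α (k + 2) = r1 at *
  rw [pow_succ] at hdet d2
  obtain ⟨s, hs, hsZ, hsR⟩ : ∃ s : ℤ, s * s = 1 ∧ (-1 : ℤ) ^ k = s ∧ (-1 : ℝ) ^ k = s :=
    ⟨(-1) ^ k, by rw [← mul_pow]; simp, rfl, by simp⟩
  rw [hsZ] at hdet
  rw [hsR] at d1 d2
  -- These are the coordinates of (i, j) in the unimodular basis formed by two consecutive
  -- convergents, whose errors have opposite signs. The range of i forces A ≤ 0 with B ≥ 1, or A > 0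
  -- with B ≤ -1, so both contributions to the error add up.
  set A : ℤ := -s * (i * P0 - j * Q0) with hA
  set B : ℤ := -s * (j * Q1 - i * P1) with hB
  have hi' : (i : ℤ) = A * Q1 + B * Q0 := by
    rw [hA, hB]; linear_combination (s * i : ℤ) * hdet - (i : ℤ) * hs
  have hj' : j = A * P1 + B * P0 := by
    rw [hA, hB]; linear_combination (s * j : ℤ) * hdet - j * hs
  clear_value A B
  have hiR : (i : ℝ) = A * Q1 + B * Q0 := by exact_mod_cast hi'
  have hjR : (j : ℝ) = A * P1 + B * P0 := by exact_mod_cast hj'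
  have hval : (i : ℝ) * α - j = s * (B * r0 - A * r1) := by
    rw [hiR, hjR]; linear_combination (A : ℝ) * d2 + B * d1
  have hsabs : |(s : ℝ)| = 1 := by
    have : s = 1 ∨ s = -1 := by
      rcases Int.mul_eq_one_iff_eq_one_or_neg_one.1 hs with h | h
      · exact Or.inl h.1
      · exact Or.inr h.1
    rcases this with h | h <;> simp [h]
  rw [hval, abs_mul, hsabs, one_mul]
  rcases le_or_gt A 0 with hA0 | hA0
  · have hB1 : 1 ≤ B := by
      by_contra h
      have : B ≤ 0 := by omega
      have h3 : A * Q1 ≤ 0 := mul_nonpos_of_nonpos_of_nonneg hA0 (by positivity)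
      have h4 : B * Q0 ≤ 0 := mul_nonpos_of_nonpos_of_nonneg this (by positivity)
      omega
    have hB1' : (1 : ℝ) ≤ B := by exact_mod_cast hB1
    have hA0' : (A : ℝ) ≤ 0 := by exact_mod_cast hA0
    refine le_trans ?_ (le_abs_self _)
    nlinarith
  · have hB1 : B ≤ -1 := by
      by_contra h
      have : 0 ≤ B := by omega
      have h4 : 0 ≤ B * Q0 := mul_nonneg this (by positivity)
      have h5 : (Q1 : ℤ) ≤ A * Q1 := by nlinarith
      omega
    have hB1' : (B : ℝ) ≤ -1 := by exact_mod_cast hB1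
    have hA0' : (0 : ℝ) < A := by exact_mod_cast hA0
    refine le_trans ?_ (neg_le_abs _)
    nlinarith

/-- A one-sided record of the sequence `q ↦ q α` is a vector of a suitable lattice basis. -/
lemma eq_of_one_sided_record {Q0 P0 Q1 P1 q p : ℤ} {s : ℝ}
    (hdet : (Q1 * P0 - P1 * Q0) * (Q1 * P0 - P1 * Q0) = 1) (hQ1 : 0 < Q1) (hQ0 : 0 < Q0)
    (hd0 : 0 < s * (Q0 * α - P0)) (hd1 : s * (Q1 * α - P1) < 0) (hle : Q0 ≤ q)
    (hlt : q < Q0 + Q1) (hq : 0 < s * (q * α - p))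
    (hrec : Q0 < q → s * (q * α - p) < s * (Q0 * α - P0)) : q = Q0 := by
  by_contra hne
  have hrec := hrec (lt_of_le_of_ne hle (Ne.symm hne))
  set D := Q1 * P0 - P1 * Q0 with hD
  set A : ℤ := D * (p * Q1 - q * P1) with hA
  set B : ℤ := D * (q * P0 - p * Q0) with hB
  have hq' : q = A * Q0 + B * Q1 := by
    rw [hA, hB]; linear_combination (-q) * hdet + (q * D) * hD
  have hp' : p = A * P0 + B * P1 := by
    rw [hA, hB]; linear_combination (-p) * hdet + (p * D) * hD
  clear_value A B
  have hqR : (q : ℝ) = A * Q0 + B * Q1 := by exact_mod_cast hq'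
  have hpR : (p : ℝ) = A * P0 + B * P1 := by exact_mod_cast hp'
  have hval : s * (q * α - p) = A * (s * (Q0 * α - P0)) + B * (s * (Q1 * α - P1)) := by
    rw [hqR, hpR]; ring
  rw [hval] at hq hrec
  generalize s * (Q0 * α - P0) = d0 at *
  generalize s * (Q1 * α - P1) = d1 at *
  -- A nonpositive A would need B < 0 to keep the error positive, making q negative. For A ≥ 1, a B
  -- ≤ 0 gives an error of at least that of Q0, and B > 0 makes q at least Q0 + Q1.
  rcases le_or_gt A 0 with hA0 | hA0
  · have hA0' : (A : ℝ) ≤ 0 := by exact_mod_cast hA0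
    have hB0 : B < 0 := by
      by_contra h
      have hB0' : (0 : ℝ) ≤ B := by exact_mod_cast not_lt.1 h
      nlinarith
    nlinarith
  · have hA0' : (1 : ℝ) ≤ A := by exact_mod_cast hA0
    rcases lt_trichotomy B 0 with hB | hB | hB
    · have hB0' : (B : ℝ) < 0 := by exact_mod_cast hB
      nlinarith
    · rw [hB] at hrec
      push_cast at hrec
      nlinarith
    · nlinarith

/-! ### Crossing the point `0` -/

lemma arcCode_eq_of_floor (h0 : 0 < α) (h1 : α < 1) {x y : ℝ} (h : ⌊x⌋ = ⌊y⌋)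
    (h' : ⌊x - α⌋ = ⌊y - α⌋) : arcCode α x = arcCode α y := by
  have hx := floor_sub_floor_eq_arcCode h0 h1 x
  have hy := floor_sub_floor_eq_arcCode h0 h1 y
  rw [h, h', ← hy] at hx
  exact Fin.ext (by exact_mod_cast hx)

/-- If the only crossing between `-t` and `t` is `0`, the two orbit words differ exactly in the
first two letters, which are exchanged. -/
lemma exists_orbitWord_swap (h0 : 0 < α) (h2 : α < 1 / 2) {t : ℝ} (ht : 0 < t) (htα : t < α)
    {n : ℕ} (hn : 2 ≤ n) (h : ∀ i : ℕ, 1 ≤ i → i < n → ∀ j : ℤ, t < |i * α - j|) :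
    ∃ v : Word, orbitWord α t n = 1 :: 0 :: v ∧ orbitWord α (-t) n = 0 :: 1 :: v := by
  have h1 : α < 1 := by linarith
  obtain ⟨m, rfl⟩ := Nat.exists_eq_add_of_le hn
  have a1 : arcCode α t = 1 := arcCode_eq_one 0 (by simpa using ht.le) (by simpa using htα) h1
  have a2 : arcCode α (t + α) = 0 := by
    refine arcCode_eq_zero 0 h0 ?_ ?_ <;> push_cast <;> linarith
  have a3 : arcCode α (-t) = 0 := by
    refine arcCode_eq_zero (-1) h0 ?_ ?_ <;> push_cast <;> linarith
  have a4 : arcCode α (-t + α) = 1 := by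
    refine arcCode_eq_one 0 ?_ ?_ h1 <;> push_cast <;> linarith
  -- Letter i depends only on the floors at i and i - 1. They agree for i ≥ 1, so the jump at i = 0
  -- affects letters 0 and 1 only.
  have hfl : ∀ i : ℕ, 1 ≤ i → i < 2 + m → ⌊t + i * α⌋ = ⌊-t + i * α⌋ := by
    intro i hi him
    rw [floor_eq_floor_iff]
    intro j
    have := h i hi him j
    constructor
    · intro h3
      rcases lt_abs.1 this with h4 | h4 <;> linarith
    · intro h3
      linarith
  refine ⟨orbitWord α (t + (2 : ℕ) * α) m, ?_, ?_⟩
  · rw [orbitWord_add]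
    simp [orbitWord, List.range_succ, a1, a2]
  · have : orbitWord α (t + (2 : ℕ) * α) m = orbitWord α (-t + (2 : ℕ) * α) m := by
      rw [orbitWord_eq_orbitWord_iff]
      intro i hi
      have h3 := hfl (i + 2) (by omega) (by omega)
      have h4 := hfl (i + 1) (by omega) (by omega)
      push_cast at h3 h4
      apply arcCode_eq_of_floor h0 h1
      · rw [show t + (2 : ℕ) * α + i * α = t + (i + 2) * α by push_cast; ring,
          show -t + (2 : ℕ) * α + i * α = -t + (i + 2) * α by push_cast; ring, h3]
      · rw [show t + (2 : ℕ) * α + i * α - α = t + (i + 1) * α by push_cast; ring,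
          show -t + (2 : ℕ) * α + i * α - α = -t + (i + 1) * α by push_cast; ring, h4]
    rw [this, orbitWord_add]
    simp [orbitWord, List.range_succ, a3, a4]

lemma orbitWord_swapFirstTwo_reverse_standardWord (hα : Irrational α) (h0 : 0 < α)
    (h2 : α < 1 / 2) (k : ℕ) (t : ℝ) (ht : 0 < t) (htk : t < remainder α (k + 1)) :
    orbitWord α ((-1) ^ (k + 1) * t) (convLength α (k + 1)) =
      swapFirstTwo (standardWord α (k + 1)).reverse := by
  have h1 : α < 1 := by linarith
  have hle := remainder_le_self hα h0 h1 k
  have hlen : 2 ≤ convLength α (k + 1) := by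
    have := convLength_lt_succ hα h0 h1 (two_le_partialQuotient_one hα h0 h2) k
    have := convLength_pos (α := α) k
    omega
  obtain ⟨v, hv1, hv2⟩ := exists_orbitWord_swap h0 h2 ht (htk.trans_le hle) hlen
    (fun i hi hik j => htk.trans_le (remainder_le_abs hα h0 h1 k hi hik j))
  rw [← orbitWord_reverse_standardWord hα h0 h2 (k + 1) t ht htk (by linarith)]
  rcases neg_one_pow_eq_or ℝ (k + 1) with h | h <;> rw [h]
  · rw [one_mul, neg_one_mul, hv1, hv2, swapFirstTwo]
  · rw [neg_neg, neg_one_mul, one_mul, hv1, hv2, swapFirstTwo]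

/-! ### Primitivity -/

/-- The exponent of a power divides both the length and the number of ones; for the words here
coprimality comes from the determinant of consecutive convergents. -/
lemma isPrimitive_of_isCoprime {w : Word} (h : IsCoprime (w.length : ℤ) (w.count 1 : ℤ)) :
    IsPrimitive w := by
  rintro z n rfl
  rw [length_wordPow, count_wordPow] at h
  push_cast at h
  have h2 : IsUnit (n : ℤ) := h.isUnit_of_dvd' (dvd_mul_right _ _) (dvd_mul_right _ _)
  exact Nat.isUnit_iff.1 (Int.ofNat_isUnit.1 h2)

lemma isPrimitive_reverse_semistandardWord (k l : ℕ) :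
    IsPrimitive (semistandardWord α k l).reverse := by
  apply isPrimitive_of_isCoprime
  rw [List.length_reverse, List.count_reverse, length_semistandardWord, count_semistandardWord]
  have hdet := convLength_det (α := α) k
  have hs : ((-1 : ℤ) ^ (k + 1)) * (-1) ^ (k + 1) = 1 := by rw [← mul_pow]; simp
  refine ⟨-(-1) ^ (k + 1) * convHeight α (k + 1), (-1) ^ (k + 1) * convLength α (k + 1), ?_⟩
  push_cast
  linear_combination (-1) ^ (k + 1) * hdet + hs

lemma isPrimitive_reverse_standardWord (k : ℕ) : IsPrimitive (standardWord α k).reverse := by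
  rw [← semistandardWord_zero]
  exact isPrimitive_reverse_semistandardWord k 0

lemma swapFirstTwo_perm (w : Word) : (swapFirstTwo w).Perm w := by
  rcases w with _ | ⟨x, _ | ⟨y, t⟩⟩
  · exact List.Perm.refl _
  · exact List.Perm.refl _
  · exact List.Perm.swap _ _ _

lemma isPrimitive_swapFirstTwo_reverse_standardWord (k : ℕ) :
    IsPrimitive (swapFirstTwo (standardWord α k).reverse) := by
  apply isPrimitive_of_isCoprime
  rw [(swapFirstTwo_perm _).length_eq, (swapFirstTwo_perm _).count_eq, List.length_reverse,
    List.count_reverse]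
  have hdet := convLength_det (α := α) k
  have hs : ((-1 : ℤ) ^ (k + 1)) * (-1) ^ (k + 1) = 1 := by rw [← mul_pow]; simp
  refine ⟨-(-1) ^ (k + 1) * convHeight α (k + 1), (-1) ^ (k + 1) * convLength α (k + 1), ?_⟩
  change _ * (convLength α k : ℤ) + _ * (convHeight α k : ℤ) = 1
  linear_combination (-1) ^ (k + 1) * hdet + hs

/-! ### Squares of reversed standard words -/

/-- If all points close to `0` on one side start with `w` and the rotation by `w.length * α` does
not move too far, then the square of `w` occurs with no crossing. -/
lemma exists_squareAt_of_range (h0 : 0 < α) (h1 : α < 1) {w : Word} {s b a c d : ℝ} {p : ℤ}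
    (hs : s = 1 ∨ s = -1)
    (hrange : ∀ t, 0 < t → t < b → orbitWord α (s * t) w.length = w)
    (hI : ∀ t, 0 < t → t < b → s * t ∈ Ioo (α - 1) α)
    (hd : w.length * α - p = s * d) (hac : a < c) (ha : 0 ≤ a) (hcb : c ≤ b) (had : 0 ≤ a + d)
    (hcd : c + d ≤ b) :
    ∃ u ∈ Ioo (α - 1) α, Generic α u ∧ SquareAt α u w ∧ NoCrossing α u w.length := by
  obtain ⟨t, ht1, ht2, hg⟩ : ∃ t, a < t ∧ t < c ∧ Generic α (s * t) := by
    rcases hs with rfl | rfl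
    · obtain ⟨v, hv, hg⟩ := exists_generic α hac
      exact ⟨v, hv.1, hv.2, by rwa [one_mul]⟩
    · obtain ⟨v, hv, hg⟩ := exists_generic α (neg_lt_neg hac)
      exact ⟨-v, by linarith [hv.2], by linarith [hv.1], by simpa using hg⟩
  have ht0 : 0 < t := by linarith
  have htI := hI t ht0 (by linarith)
  have hword := hrange t ht0 (by linarith)
  refine ⟨s * t, htI, hg, SquareAt.of_shift p hd.symm hword ?_, ?_⟩
  · rw [← mul_add]
    exact hrange _ (by linarith) (by linarith)
  -- The word w is read arbitrarily close to 0, so a crossing x would separate s * t from a point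
  -- halfway between 0 and x.
  · intro i hi hiw j
    generalize hx : (j - i * α : ℝ) = x
    have hsep : ∀ t', 0 < t' → t' < b → (x ≤ s * t' ↔ x ≤ s * t) := by
      intro t' h3 h4
      rw [← hx]
      exact (orbitWord_eq_iff h0 h1 (hI t' h3 h4) htI _).1
        ((hrange t' h3 h4).trans hword.symm) i hiw j
    rcases hs with rfl | rfl
    · refine ⟨fun h3 h4 => ?_, fun h3 h4 => by linarith⟩
      have := (hsep (x / 2) (by linarith) (by linarith)).2 h4.le
      linarith
    · refine ⟨fun h3 h4 => by linarith, fun h3 h4 => ?_⟩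
      have := (hsep (-x / 2) (by linarith) (by linarith)).1 (by linarith)
      linarith

lemma neg_neg_one_pow_eq_or (k : ℕ) : -(-1 : ℝ) ^ k = 1 ∨ -(-1 : ℝ) ^ k = -1 := by
  rcases neg_one_pow_eq_or ℝ k with h | h <;> rw [h] <;> simp

/-- Reading the word moves the point towards 0 by r_{k+1}, which leaves room since r_{k+1} is less
than both r_k and 1 - α. -/
lemma exists_squareAt_reverse_standardWord (hα : Irrational α) (h0 : 0 < α) (h2 : α < 1 / 2)
    (k : ℕ) : ∃ u ∈ Ioo (α - 1) α, Generic α u ∧ SquareAt α u (standardWord α k).reverse ∧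
      NoCrossing α u (standardWord α k).reverse.length := by
  have h1 : α < 1 := by linarith
  have ha := one_le_partialQuotient hα h0 h1 0
  have hpos := remainder_pos hα h0 h1 (k + 1)
  have hlt := remainder_succ_lt hα h0 h1 k
  have hle := remainder_le_self hα h0 h1 k
  have hmin := min_le_left (remainder α k) (1 - α)
  have hmin' := min_le_right (remainder α k) (1 - α)
  refine exists_squareAt_of_range h0 h1 (s := -(-1) ^ k) (b := min (remainder α k) (1 - α))
    (a := remainder α (k + 1)) (c := min (remainder α k) (1 - α)) (d := -remainder α (k + 1))
    (p := convHeight α k) (neg_neg_one_pow_eq_or k) ?_ ?_ ?_ ?_ hpos.le le_rfl (by linarith)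
    (by linarith)
  · intro t ht htb
    rw [List.length_reverse]
    exact orbitWord_reverse_standardWord hα h0 h2 k t ht (by linarith) (by linarith)
  · intro t ht htb
    rcases k with _ | k
    · rw [pow_zero]; constructor <;> linarith
    · have := remainder_le_self hα h0 h1 k
      rcases neg_neg_one_pow_eq_or (k + 1) with h | h <;> rw [h] <;> constructor <;> linarith
  · rw [List.length_reverse]
    have := convLength_mul_sub ha k
    rw [convLength] at this
    push_cast
    linear_combination this
  · exact lt_min hlt (by linarith)

lemma exists_squareAt_reverse_semistandardWord (hα : Irrational α) (h0 : 0 < α) (h2 : α < 1 / 2)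
    (k l : ℕ) (hl1 : 1 ≤ l) (hl : l ≤ partialQuotient α (k + 2)) :
    ∃ u ∈ Ioo (α - 1) α, Generic α u ∧ SquareAt α u (semistandardWord α k l).reverse ∧
      NoCrossing α u (semistandardWord α k l).reverse.length := by
  have h1 : α < 1 := by linarith
  have ha := one_le_partialQuotient hα h0 h1 0
  have hpos := remainder_pos hα h0 h1 (k + 3)
  have hpos2 := remainder_pos hα h0 h1 (k + 2)
  have hrec := remainder_add_two (α := α) (k + 1)
  rw [show k + 1 + 2 = k + 3 from rfl, show k + 1 + 1 = k + 2 from rfl] at hrec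
  have hle := remainder_le_self hα h0 h1 k
  obtain ⟨m, rfl⟩ := Nat.exists_eq_add_of_le' hl1
  have hm : ((m : ℝ) + 1) * remainder α (k + 2) ≤
      partialQuotient α (k + 2) * remainder α (k + 2) := by
    gcongr
    exact_mod_cast hl
  have hm0 : 0 ≤ (m : ℝ) * remainder α (k + 2) := by positivity
  have hlen := length_semistandardWord (α := α) k (m + 1)
  refine exists_squareAt_of_range h0 h1 (s := -(-1) ^ k)
    (b := remainder α (k + 1) - m * remainder α (k + 2))
    (a := remainder α (k + 1) - (m + 1) * remainder α (k + 2))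
    (c := remainder α (k + 1) - m * remainder α (k + 2))
    (d := -(remainder α (k + 1) - (m + 1) * remainder α (k + 2)))
    (p := ((m + 1) * convHeight α (k + 1) + convHeight α k : ℕ)) (neg_neg_one_pow_eq_or k)
    ?_ ?_ ?_ (by linarith) (by linarith) le_rfl (by linarith) (by linarith)
  · intro t ht htb
    rw [List.length_reverse, hlen]
    exact orbitWord_reverse_semistandardWord hα h0 h2 k m t ht htb
  · intro t ht htb
    rcases neg_neg_one_pow_eq_or k with h | h <;> rw [h] <;> constructor <;> linarith
  · rw [List.length_reverse, hlen, Int.cast_natCast, semistandard_mul_sub ha]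
    push_cast
    ring

/-- On this side of 0 the displacement r_{k+2} points away from 0, and r_{k+2} < r_{k+1} leaves room
for it. -/
lemma exists_squareAt_swapFirstTwo (hα : Irrational α) (h0 : 0 < α) (h2 : α < 1 / 2) (k : ℕ) :
    ∃ u ∈ Ioo (α - 1) α, Generic α u ∧
      SquareAt α u (swapFirstTwo (standardWord α (k + 1)).reverse) ∧
      NoCrossing α u (swapFirstTwo (standardWord α (k + 1)).reverse).length := by
  have h1 : α < 1 := by linarith
  have ha := one_le_partialQuotient hα h0 h1 0
  have hpos := remainder_pos hα h0 h1 (k + 2)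
  have hlt := remainder_succ_lt hα h0 h1 (k + 1)
  have hle := remainder_le_self hα h0 h1 k
  rw [show k + 1 + 1 = k + 2 from rfl] at hlt
  have hlen : (swapFirstTwo (standardWord α (k + 1)).reverse).length = convLength α (k + 1) := by
    rw [(swapFirstTwo_perm _).length_eq, List.length_reverse, convLength]
  refine exists_squareAt_of_range h0 h1 (s := (-1) ^ (k + 1)) (b := remainder α (k + 1))
    (a := 0) (c := remainder α (k + 1) - remainder α (k + 2)) (d := remainder α (k + 2))
    (p := convHeight α (k + 1)) (neg_one_pow_eq_or ℝ _) ?_ ?_ ?_ (by linarith) le_rfl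
    (by linarith) (by linarith) (by linarith)
  · intro t ht htb
    rw [hlen]
    exact orbitWord_swapFirstTwo_reverse_standardWord hα h0 h2 k t ht htb
  · intro t ht htb
    rcases neg_one_pow_eq_or ℝ (k + 1) with h | h <;> rw [h] <;> constructor <;> linarith
  · rw [hlen, Int.cast_natCast]
    exact convLength_mul_sub ha (k + 1)

/-! ### Classification -/

/-- Without crossings w is read arbitrarily close to 0 on the side of u, so its length and that side
determine it. -/
lemma NoCrossing.eq_of_range (h0 : 0 < α) (h1 : α < 1) {u s b : ℝ} {w v : Word}
    (hs : s = 1 ∨ s = -1) (hu : u ∈ Ioo (α - 1) α) (hgu : Generic α u)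
    (hwu : orbitWord α u w.length = w) (hN : NoCrossing α u w.length) (hsu : 0 < s * u)
    (hb : 0 < b) (hrange : ∀ t, 0 < t → t < b → orbitWord α (s * t) w.length = v) : w = v := by
  have ht : 0 < min (s * u) (b / 2) := lt_min hsu (by linarith)
  have htb : min (s * u) (b / 2) < b := (min_le_right _ _).trans_lt (by linarith)
  have htu := min_le_left (s * u) (b / 2)
  rw [← hrange _ ht htb, hN.orbitWord_eq h0 h1 hu hgu, hwu]
  rcases hs with rfl | rfl
  · left; constructor <;> linarith
  · right; constructor <;> linarith

lemma exists_convLength_le_lt (hα : Irrational α) (h0 : 0 < α) (h2 : α < 1 / 2) {q : ℕ}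
    (hq : 1 ≤ q) : ∃ k, convLength α k ≤ q ∧ q < convLength α (k + 1) := by
  classical
  have hmono : StrictMono (convLength α) := strictMono_nat_of_lt_succ
    (convLength_lt_succ hα h0 (by linarith) (two_le_partialQuotient_one hα h0 h2))
  have hex : ∃ k, q < convLength α k := ⟨q + 1, hmono.id_le (q + 1)⟩
  have hspec := Nat.find_spec hex
  rcases hk : Nat.find hex with _ | k
  · rw [hk, convLength_zero] at hspec
    omega
  · rw [hk] at hspec
    exact ⟨k, not_lt.1 (Nat.find_min hex (by omega)), hspec⟩

/-- The primitive words whose squares occur with no crossing are the reversals of standard and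
semistandard words and the words obtained from reversals of standard words by exchanging the first
two letters. -/
lemma NoCrossing.mem_reversed (hα : Irrational α) (h0 : 0 < α) (h2 : α < 1 / 2) {u : ℝ}
    {w : Word} (hw : IsPrimitive w) (hu : u ∈ Ioo (α - 1) α) (hgu : Generic α u)
    (hs : SquareAt α u w) (hN : NoCrossing α u w.length) :
    w ∈ reversedSemiStandardWords α ∪
        swapFirstTwo '' {u | u ∈ reversedStandardWords α ∧ 2 ≤ u.length} := by
  have h1 : α < 1 := by linarith
  have ha := one_le_partialQuotient hα h0 h1 0
  have ha2 := two_le_partialQuotient_one hα h0 h2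
  obtain ⟨δ, p, hδ, hv, hgv, hwu, hwv⟩ := hs.exists_shift hgu
  have hq : 1 ≤ w.length := List.length_pos_iff.2 hw.ne_nil
  have hsign := nonneg_iff_of_orbitWord_eq h0 h1 hu hv hq (hwu.trans hwv.symm)
  have hu0 := hgu.ne_zero
  have hv0 := hgv.ne_zero
  have hN' : NoCrossing α (u + δ) w.length :=
    hN.of_orbitWord_eq h0 h1 hu hv hgu (hwu.trans hwv.symm)
  have hδ0 : δ ≠ 0 := by
    intro h
    have h3 : (w.length * α : ℝ) = (p : ℤ) := by linarith
    exact (hα.natCast_mul (m := w.length) (by omega)).ne_int p h3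
  have hrec := fun (i : ℕ) (hi : 1 ≤ i) (hiw : i < w.length) (j : ℤ) =>
    hs.not_mem_uIcc h0 h1 hw hu hv hwv hi hiw j
  have hδ1 : |δ| < 1 := by
    rw [abs_lt]
    constructor <;> linarith [hu.1, hu.2, hv.1, hv.2]
  -- the record property on the side of `δ`
  have hone : ∀ s : ℝ, (s = 1 ∨ s = -1) → 0 < s * δ → ∀ i : ℕ, 1 ≤ i → i < w.length → ∀ j : ℤ,
      0 < s * (i * α - j) → s * δ < s * (i * α - j) := by
    intro s hs1 hsδ i hi hiw j hpos
    by_contra hcon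
    apply hrec i hi hiw j
    rw [mem_uIcc]
    rcases hs1 with rfl | rfl
    · left; constructor <;> linarith
    · right; constructor <;> linarith
  -- the record property on the other side
  have htwo : ∀ s : ℝ, (s = 1 ∨ s = -1) → 0 < s * δ → 0 < s * u → ∀ i : ℕ, 1 ≤ i →
      i < w.length → ∀ j : ℤ, 0 < s * (j - i * α) → s * δ < s * (j - i * α) := by
    intro s hs1 hsδ hsu i hi hiw j hpos
    by_contra hcon
    have := hN' i hi hiw j
    rcases hs1 with rfl | rfl
    · exact this.1 (by linarith) (by linarith)
    · exact this.2 (by linarith) (by linarith)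
  obtain ⟨k, hk1, hk2⟩ := exists_convLength_le_lt hα h0 h2 hq
  have hsk : ((-1 : ℝ) ^ k) * (-1) ^ k = 1 := by rw [← mul_pow]; simp
  have hk0 := neg_one_pow_eq_or ℝ k
  have dk := convLength_mul_sub ha k
  have dk' := convLength_mul_sub ha (k + 1)
  have rk := remainder_pos hα h0 h1 (k + 1)
  have rk' := remainder_pos hα h0 h1 (k + 2)
  rw [show k + 1 + 1 = k + 2 from rfl] at dk'
  have hne : (-1 : ℝ) ^ k * δ ≠ 0 := mul_ne_zero (by positivity) hδ0
  have hneu : (-1 : ℝ) ^ k * u ≠ 0 := mul_ne_zero (by positivity) hu0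
  rcases lt_or_gt_of_ne hne with hside | hside
  · rcases k with _ | m
    · -- lengths below `a₁`
      exfalso
      rw [pow_zero, one_mul] at hside
      rw [convLength_one ha] at hk2
      have h3 := remainder_add_two (α := α) 0
      have h4 := remainder_pos hα h0 h1 2
      simp only [remainder_zero, zero_add, remainder_one] at h3
      have h5 : (w.length : ℝ) + 1 ≤ partialQuotient α 1 := by exact_mod_cast hk2
      have h6 : ((w.length : ℝ) + 1) * α ≤ partialQuotient α 1 * α := by gcongr
      have h7 : 0 < (w.length : ℝ) * α := by
        have : (0 : ℝ) < w.length := by exact_mod_cast hq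
        positivity
      have hp1 : p = 1 := by
        have h8 : (0 : ℝ) < p := by linarith
        have h9 : (p : ℝ) < 2 := by linarith [(abs_lt.1 hδ1).1]
        have h8' : 0 < p := by exact_mod_cast h8
        have h9' : p < 2 := by exact_mod_cast h9
        omega
      rw [hp1, Int.cast_one] at hδ
      rcases lt_or_gt_of_ne hu0 with hneg | hpos
      · rcases (show w.length = 1 ∨ 1 < w.length by omega) with h10 | h10
        · rw [h10, Nat.cast_one, one_mul] at hδ
          linarith [hv.1]
        · have := htwo (-1) (Or.inr rfl) (by linarith) (by linarith) 1 le_rfl h10 0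
            (by push_cast; linarith)
          push_cast at this
          linarith
      · have := hsign.1 hpos.le
        linarith [hu.2]
    · -- semistandard lengths
      have dm := convLength_mul_sub ha m
      have hdet := convLength_det (α := α) m
      have hqm := convLength_pos (α := α) m
      have hqm' := convLength_pos (α := α) (m + 1)
      have hlt := convLength_lt_succ hα h0 h1 ha2 m
      rw [show m + 1 + 1 = m + 2 from rfl, convLength_add_two] at hk2
      have rm := remainder_pos hα h0 h1 (m + 3)
      have hr := remainder_add_two (α := α) (m + 1)
      rw [show m + 1 + 2 = m + 3 from rfl] at hr
      rw [show m + 1 + 1 = m + 2 from rfl] at hr rk dk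
      have hsm : ((-1 : ℝ) ^ m) * (-1) ^ m = 1 := by rw [← mul_pow]; simp
      have hm0 := neg_one_pow_eq_or ℝ m
      have hside' : 0 < (-1 : ℝ) ^ m * δ := by
        rw [pow_succ] at hside
        linarith
      -- The multiplier l is the quotient of |w| - q_m by q_{m+1}, so that |w| falls in the window
      -- of the record criterion.
      obtain ⟨l, hl1, hl2⟩ : ∃ l, l * convLength α (m + 1) + convLength α m ≤ w.length ∧
          w.length < (l + 1) * convLength α (m + 1) + convLength α m := by
        refine ⟨(w.length - convLength α m) / convLength α (m + 1), ?_, ?_⟩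
        · have := Nat.div_mul_le_self (w.length - convLength α m) (convLength α (m + 1))
          omega
        · have := Nat.div_add_mod' (w.length - convLength α m) (convLength α (m + 1))
          have := Nat.mod_lt (w.length - convLength α m) hqm'
          rw [Nat.succ_mul]
          omega
      have hla : l < partialQuotient α (m + 2) := by
        by_contra h
        have := Nat.mul_le_mul_right (convLength α (m + 1)) (not_lt.1 h)
        omega
      have hlaR : (l : ℝ) + 1 ≤ partialQuotient α (m + 2) := by exact_mod_cast hla
      have hlm : ((l : ℝ) + 1) * remainder α (m + 2) ≤
        partialQuotient α (m + 2) * remainder α (m + 2) := by gcongr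
      have dl := semistandard_mul_sub ha m l
      have hD : 0 < remainder α (m + 1) - l * remainder α (m + 2) := by linarith
      have hdl : (-1 : ℝ) ^ m * (((l * convLength α (m + 1) + convLength α m : ℕ) : ℝ) * α -
          ((l * convHeight α (m + 1) + convHeight α m : ℕ) : ℝ)) =
          remainder α (m + 1) - l * remainder α (m + 2) := by
        rw [dl, ← mul_assoc, hsm, one_mul]
      have hlen : (w.length : ℤ) = (l * convLength α (m + 1) + convLength α m : ℕ) := by
        refine eq_of_one_sided_record (α := α) (s := (-1) ^ m) (p := p)
          (P0 := (l * convHeight α (m + 1) + convHeight α m : ℕ))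
          (Q1 := convLength α (m + 1)) (P1 := convHeight α (m + 1)) ?_ ?_ ?_ ?_ ?_ ?_ ?_ ?_ ?_
        · push_cast
          rw [show ((convLength α (m + 1) : ℤ) * (l * convHeight α (m + 1) + convHeight α m) -
            convHeight α (m + 1) * (l * convLength α (m + 1) + convLength α m)) =
            (-1) ^ (m + 1) by rw [← hdet]; ring, ← mul_pow]
          simp
        · exact_mod_cast hqm'
        · exact_mod_cast (by omega : 0 < l * convLength α (m + 1) + convLength α m)
        · rw [Int.cast_natCast, Int.cast_natCast, hdl]
          exact hD
        · rw [Int.cast_natCast, Int.cast_natCast, dk, ← mul_assoc, pow_succ, ← mul_assoc, hsm]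
          linarith
        · exact_mod_cast hl1
        · have : w.length < (l * convLength α (m + 1) + convLength α m) + convLength α (m + 1) := by
            linarith
          exact_mod_cast this
        · rw [Int.cast_natCast, ← hδ]
          exact hside'
        · intro hlt
          rw [Int.cast_natCast, ← hδ, Int.cast_natCast]
          have := hone _ hm0 hside' (l * convLength α (m + 1) + convLength α m) (by omega)
            (by exact_mod_cast hlt) (l * convHeight α (m + 1) + convHeight α m : ℕ)
          rw [Int.cast_natCast] at this
          exact this (by rw [hdl]; exact hD)
      have hlen' : w.length = l * convLength α (m + 1) + convLength α m := by exact_mod_cast hlen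
      have hl0 : l ≠ 0 := by
        rintro rfl
        omega
      obtain ⟨l', rfl⟩ := Nat.exists_eq_succ_of_ne_zero hl0
      have hl'0 : (0 : ℝ) ≤ l' * remainder α (m + 2) := by positivity
      push_cast at hD hlm
      have hneu' : (-1 : ℝ) ^ m * u ≠ 0 := mul_ne_zero (by positivity) hu0
      rcases lt_or_gt_of_ne hneu' with hus | hus
      · left
        refine ⟨semistandardWord α m (l' + 1), Or.inr ⟨m, l' + 1, by omega, hla, rfl⟩, ?_⟩
        refine (hN.eq_of_range h0 h1 (s := -(-1) ^ m)
          (b := remainder α (m + 1) - l' * remainder α (m + 2)) (neg_neg_one_pow_eq_or m) hu hgu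
          hwu (by linarith) (by linarith) fun t ht htb => ?_).symm
        rw [hlen']
        exact orbitWord_reverse_semistandardWord hα h0 h2 m l' t ht htb
      -- If u and δ were on the same side, the point of index q_{m+1}, at distance r_{m+2} from 0,
      -- would force |δ| < r_{m+2}. But |δ| is r_{m+1} minus at most a_{m+2} - 1 copies of r_{m+2},
      -- which exceeds r_{m+2}.
      · exfalso
        have hiw : convLength α (m + 1) < w.length := by
          rw [hlen', Nat.succ_mul]
          omega
        have h3 : (-1 : ℝ) ^ m * ((convHeight α (m + 1) : ℤ) - convLength α (m + 1) * α) =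
            remainder α (m + 2) := by
          rw [Int.cast_natCast]
          rw [pow_succ] at dk
          linear_combination (-(-1) ^ m) * dk + remainder α (m + 2) * hsm
        have h4 := htwo _ hm0 hside' hus (convLength α (m + 1)) (by omega) hiw
          (convHeight α (m + 1)) (by rw [h3]; exact rk)
        rw [h3] at h4
        -- `δ` is the exact remainder of the semistandard word
        have h5 : (-1 : ℝ) ^ m * δ - (remainder α (m + 1) - (l' + 1 : ℕ) * remainder α (m + 2)) =
            (-1) ^ m * (((l' + 1) * convHeight α (m + 1) + convHeight α m : ℕ) - p : ℝ) := by
          rw [← hdl, hδ, hlen']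
          ring
        have h6 := remainder_le_self hα h0 h1 m
        have h7 := remainder_le_self hα h0 h1 (m + 1)
        rw [show m + 1 + 1 = m + 2 from rfl] at h7
        -- The integer p is identified because it differs from the height of the semistandard word
        -- by less than 1.
        have h8 : |(((((l' + 1) * convHeight α (m + 1) + convHeight α m : ℕ) : ℤ) - p : ℤ) : ℝ)|
            < 1 := by
          have h9 : |(-1 : ℝ) ^ m * (((l' + 1) * convHeight α (m + 1) + convHeight α m : ℕ) - p)|
              < 1 := by
            rw [← h5, abs_lt]
            push_cast
            constructor <;> linarith
          rw [abs_mul, abs_neg_one_pow, one_mul] at h9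
          push_cast at h9 ⊢
          exact h9
        have h9 : (((l' + 1) * convHeight α (m + 1) + convHeight α m : ℕ) : ℤ) - p = 0 := by
          rw [← Int.abs_lt_one_iff]
          exact_mod_cast h8
        have h10 : ((((l' + 1) * convHeight α (m + 1) + convHeight α m : ℕ) : ℝ) - p) = 0 := by
          exact_mod_cast h9
        rw [h10, mul_zero] at h5
        push_cast at h5
        linarith
  · -- standard lengths
    have hdet := convLength_det (α := α) k
    have hlen : (w.length : ℤ) = convLength α k := by
      refine eq_of_one_sided_record (α := α) (s := (-1) ^ k) (p := p) (P0 := convHeight α k)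
        (Q1 := convLength α (k + 1)) (P1 := convHeight α (k + 1)) ?_ ?_ ?_ ?_ ?_ ?_ ?_ ?_ ?_
      · rw [hdet, ← mul_pow]
        simp
      · exact_mod_cast convLength_pos (k + 1)
      · exact_mod_cast convLength_pos k
      · rw [Int.cast_natCast, Int.cast_natCast, dk, ← mul_assoc, hsk]
        linarith
      · rw [Int.cast_natCast, Int.cast_natCast, dk', ← mul_assoc, pow_succ, ← mul_assoc, hsk]
        linarith
      · exact_mod_cast hk1
      · have := convLength_pos (α := α) k
        omega
      · rw [Int.cast_natCast, ← hδ]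
        exact hside
      · intro hlt
        rw [Int.cast_natCast, ← hδ, Int.cast_natCast]
        have := hone _ hk0 hside (convLength α k) (convLength_pos k) (by exact_mod_cast hlt)
          (convHeight α k)
        rw [Int.cast_natCast] at this
        refine this ?_
        rw [dk, ← mul_assoc, hsk]
        linarith
    have hlen' : w.length = convLength α k := by exact_mod_cast hlen
    rcases lt_or_gt_of_ne hneu with hus | hus
    · left
      refine ⟨standardWord α k, Or.inl ⟨k, rfl⟩, ?_⟩
      refine (hN.eq_of_range h0 h1 (s := -(-1) ^ k) (b := min (remainder α k) (1 - α))
        (neg_neg_one_pow_eq_or k) hu hgu hwu (by linarith)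
        (lt_min (remainder_pos hα h0 h1 k) (by linarith)) fun t ht htb => ?_).symm
      rw [hlen']
      exact orbitWord_reverse_standardWord hα h0 h2 k t ht (htb.trans_le (min_le_left _ _))
        (htb.trans_le (min_le_right _ _))
    · right
      -- For a single letter, u and δ = α - p both positive with u + δ < α would give p ≥ 1, hence δ
      -- < 0.
      rcases k with _ | k
      · exfalso
        rw [pow_zero, one_mul] at hus hside
        rw [hlen', convLength_zero, Nat.cast_one, one_mul] at hδ
        have h3 := hsign.1 hus.le
        have h4 : (0 : ℝ) < p := by linarith [hv.2]
        have h5 : (1 : ℝ) ≤ p := by exact_mod_cast (by exact_mod_cast h4 : 0 < p)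
        linarith
      · have hlen2 : 2 ≤ (standardWord α (k + 1)).length := by
          have h3 := convLength_lt_succ hα h0 h1 ha2 k
          have h4 := convLength_pos (α := α) k
          rw [convLength.eq_def α (k + 1)] at h3
          omega
        refine ⟨(standardWord α (k + 1)).reverse,
          ⟨⟨_, ⟨k + 1, rfl⟩, rfl⟩, by rwa [List.length_reverse]⟩, ?_⟩
        refine (hN.eq_of_range h0 h1 (s := (-1) ^ (k + 1)) (b := remainder α (k + 1)) hk0 hu hgu
          hwu hus (remainder_pos hα h0 h1 (k + 1)) fun t ht htb => ?_).symm
        rw [hlen']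
        exact orbitWord_swapFirstTwo_reverse_standardWord hα h0 h2 k t ht htb

lemma exists_noCrossing_of_mem_reversed (hα : Irrational α) (h0 : 0 < α) (h2 : α < 1 / 2)
    {w : Word} (h : w ∈ reversedSemiStandardWords α ∪
        swapFirstTwo '' {u | u ∈ reversedStandardWords α ∧ 2 ≤ u.length}) :
    IsPrimitive w ∧ ∃ u ∈ Ioo (α - 1) α, Generic α u ∧ SquareAt α u w ∧
      NoCrossing α u w.length := by
  rcases h with ⟨v, ⟨k, rfl⟩ | ⟨k, l, hl1, hl2, rfl⟩, rfl⟩ | ⟨v, ⟨⟨_, ⟨k, rfl⟩, rfl⟩, hv⟩, rfl⟩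
  · exact ⟨isPrimitive_reverse_standardWord k, exists_squareAt_reverse_standardWord hα h0 h2 k⟩
  · exact ⟨isPrimitive_reverse_semistandardWord k l,
      exists_squareAt_reverse_semistandardWord hα h0 h2 k l hl1 hl2.le⟩
  · rcases k with _ | k
    · simp [standardWord] at hv
    · exact ⟨isPrimitive_swapFirstTwo_reverse_standardWord (k + 1),
        exists_squareAt_swapFirstTwo hα h0 h2 k⟩

end SturmianSqrt

/-! ### The equivalence -/

open SturmianSqrt
theorem theorem5p1 (α : ℝ) (hα : Irrational α) (hα0 : 0 < α) (hα2 : α < 1 / 2)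
    (c : Convention) (w : Word) (hw : w ∈ language α) :
    List.TFAE [
      IsPrimitive w ∧ IsSolutionIn α w,
      IsPrimitive w ∧ SquareRootCondition c α w,
      w ∈ reversedSemiStandardWords α ∪
        swapFirstTwo '' {u | u ∈ reversedStandardWords α ∧ 2 ≤ u.length}] := by
  have h1 : α < 1 := by linarith
  tfae_have 1 → 2 := by
    rintro ⟨hp, hsol⟩
    exact ⟨hp, (squareRootCondition_iff hα0 h1 c w).2
      ⟨hsol.2.1, hsol.halvingCondition hα hα0 hα2⟩⟩
  tfae_have 2 → 3 := by
    rintro ⟨hp, hsrc⟩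
    obtain ⟨hsq, hH⟩ := (squareRootCondition_iff hα0 h1 c w).1 hsrc
    obtain ⟨u, hu, hgu, hs⟩ := (sq_mem_language_iff hα0 h1).1 hsq
    exact (hH.noCrossing hα0 h1 hp hu hgu hs).mem_reversed hα hα0 hα2 hp hu hgu hs
  tfae_have 3 → 1 := by
    intro h
    obtain ⟨hp, u, hu, hgu, hs, hN⟩ := exists_noCrossing_of_mem_reversed hα hα0 hα2 h
    exact ⟨hp, hN.isSolutionIn hα hα0 hα2 hp hu hgu hs⟩
  tfae_finish
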